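/- Let $m\ge 1$, $n,r\ge 0$ be integers and let $$G(\lambda)=P(\lambda)+C(\lambda E-A)^{-1}B\in\mathbb{C}(\lambda)^{n\times n},\qquad P(\lambda)=\sum_{j=0}^{m}\lambda^jA_j,\quad A_m\neq 0,$$ where $A_j\in\mathbb{C}^{n\times n}$, $E,A\in\mathbb{C}^{r\times r}$ with $E$ nonsingular, $C\in\mathbb{C}^{n\times r}$, $B\in\mathbb{C}^{r\times n}$. Assume that this realization is minimal, i.e. that no realization of $G$ of this form (an arbitrary matrix polynomial plus $C'(\lambda E'-A')^{-1}B'$ with $E'$ nonsingular) has a pencil $\lambda E'-A'$ of size smaller than $r$. Let $$\mathcal S(\lambda)=\begin{bmatrix}P(\lambda)&C\\ B&A-\lambda E\end{bmatrix}$$ be the associated system matrix; a system matrix is called irreducible if its realization is minimal. *Fiedler matrices.* Let $e_j$ be the $j$-th column of $I_m$. Put $M^P_{-m}=\operatorname{diag}(A_m,I_{(m-1)n})$, $M^P_0=\operatorname{diag}(I_{(m-1)n},-A_0)$, and $$M^P_i=\operatorname{diag}\left(I_{(m-i-1)n},\begin{bmatrix}-A_i&I_n\\ I_n&0\end{bmatrix},I_{(i-1)n}\right)\quad(1\le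 i\le m-1),$$ $$\mathbb M^{\mathcal S}_{-m}=\begin{bmatrix}M^P_{-m}&0\\0&-E\end{bmatrix},\quad \mathbb M^{\mathcal S}_0=\begin{bmatrix}M^P_0&-e_m\otimes C\\-e_m^T\otimes B&-A\end{bmatrix},\quad \mathbb M^{\mathcal S}_i=\begin{bmatrix}M^P_i&0\\0&I_r\end{bmatrix}\ (1\le i\le m-1).$$ For a permutation $\sigma=(\sigma_1,\dots,\sigma_m)$ of $\{0,\dots,m-1\}$ let $M^P_\sigma=M^P_{\sigma_1}\cdots M^P_{\sigma_m}$, $\mathbb M^{\mathcal S}_\sigma=\mathbb M^{\mathcal S}_{\sigma_1}\cdots\mathbb M^{\mathcal S}_{\sigma_m}$, and let $$L_\sigma(\lambda)=\lambda M^P_{-m}-M^P_\sigma,\qquad \mathbb L_\sigma(\lambda)=\lambda\mathbb M^{\mathcal S}_{-m}-\mathbb M^{\mathcal S}_\sigma$$ be the Fiedler pencils of $P(\lambda)$ and $G(\lambda)$ associated with $\sigma$. Let $c_0(\sigma)$ (resp. $i_0(\sigma)$) be the integer $p\ge 0$ such that $(0,1,\dots,p)$ (resp. $(p,\dots,1,0)$)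 is a subsequence of $\sigma$ and $(0,1,\dots,p+1)$ (resp. $(p+1,\dots,1,0)$) is not. *Rosenbrock strong linearization.* A square matrix polynomial is unimodular if its determinant is a nonzero constant; a square rational matrix is biproper if it tends to a nonsingular constant matrix as $\lambda\to\infty$. An $(mn+r)\times(mn+r)$ irreducible system matrix $$\mathbb L(\lambda)=\begin{bmatrix}\mathcal X-\lambda\mathcal Y&\mathcal C\\ \mathcal B&H-\lambda K\end{bmatrix},\qquad H,K\in\mathbb C^{r\times r},\ K \text{ nonsingular},$$ with transfer function $\mathbb G(\lambda)=\mathcal X-\lambda\mathcal Y+\mathcal C(\lambda K-H)^{-1}\mathcal B$ is a Rosenbrock strong linearization of $G(\lambda)$ if (a) and (b) below hold for $\mathbb L$ and $\mathbb G$. **Theorem.** For every permutation $\sigma$ of $\{0,\dots,m-1\}$ the Fiedler pencil $\mathbb L_\sigma(\lambda)$ is a Rosenbrock strong linearization of $G(\lambda)$; in particular it is an irreducible system matrix. More precisely: (a) There are $mn\times mn$ unimodular matrix polynomials $U(\lambda),V(\lambda)$ and nonsingular $U_0,V_0\in\mathbb C^{r\times r}$ with $$\begin{bmatrix}U(\lambda)&0\\0&U_0\end{bmatrix}\mathbb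 L_\sigma(\lambda)\begin{bmatrix}V(\lambda)&0\\0&V_0\end{bmatrix}=\begin{bmatrix}I_{(m-1)n}&0\\0&\mathcal S(\lambda)\end{bmatrix}.$$ (b) $\mathbb L_\sigma(\lambda)=\begin{bmatrix}L_\sigma(\lambda)&e_{m-i_0(\sigma)}\otimes C\\ e^T_{m-c_0(\sigma)}\otimes B&A-\lambda E\end{bmatrix}$, so that its transfer function is $\mathbb G(\lambda)=L_\sigma(\lambda)+(e_{m-i_0(\sigma)}\otimes C)(\lambda E-A)^{-1}(e^T_{m-c_0(\sigma)}\otimes B)$, and there are $mn\times mn$ biproper rational matrices $\mathcal O_\ell(\lambda),\mathcal O_r(\lambda)$ with $$\mathcal O_\ell(\lambda)\,\lambda^{-1}\mathbb G(\lambda)\,\mathcal O_r(\lambda)=\begin{bmatrix}I_{(m-1)n}&0\\0&\lambda^{-m}G(\lambda)\end{bmatrix}.$$ -/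

import Mathlib

open Polynomial

namespace Fiedler

noncomputable section

/-- A constant matrix, viewed as a matrix polynomial. -/
def const {ι κ : Type*} (M : Matrix ι κ ℂ) : Matrix ι κ ℂ[X] :=
  M.map (fun c => Polynomial.C c)

/-- A matrix polynomial, viewed as a rational matrix. -/
def toRat {ι κ : Type*} (P : Matrix ι κ ℂ[X]) : Matrix ι κ (RatFunc ℂ) :=
  P.map (algebraMap ℂ[X] (RatFunc ℂ))

/-- The matrix polynomial `∑_{j=0}^m λ^j A_j`. -/
def matPoly {ι : Type*} {m : ℕ} (A : Fin (m + 1) → Matrix ι ι ℂ) : Matrix ι ι ℂ[X] :=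
  ∑ j : Fin (m + 1), (X : ℂ[X]) ^ (j : ℕ) • const (A j)

/-! ### Realizations and system matrices -/

/-- The data of a realization `P(λ) + C (λ E - A)⁻¹ B` with an `r × r` pencil `λ E - A`,
`E` nonsingular. -/
structure Realization (ι : Type*) (r : ℕ) where
  P : Matrix ι ι ℂ[X]
  C : Matrix ι (Fin r) ℂ
  E : Matrix (Fin r) (Fin r) ℂ
  A : Matrix (Fin r) (Fin r) ℂ
  B : Matrix (Fin r) ι ℂ
  det_E : E.det ≠ 0

/-- The transfer function `P(λ) + C (λ E - A)⁻¹ B`, i.e. the rational matrix that is realized. -/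
def Realization.transfer {ι : Type*} {r : ℕ} (S : Realization ι r) :
    Matrix ι ι (RatFunc ℂ) :=
  toRat S.P +
    toRat (const S.C) * (toRat ((X : ℂ[X]) • const S.E - const S.A))⁻¹ * toRat (const S.B)

/-- The system matrix `[P(λ), C; B, A - λ E]`. -/
def Realization.systemMatrix {ι : Type*} {r : ℕ} (S : Realization ι r) :
    Matrix (ι ⊕ Fin r) (ι ⊕ Fin r) ℂ[X] :=
  Matrix.fromBlocks S.P (const S.C) (const S.B) (const S.A - (X : ℂ[X]) • const S.E)

/-- The realization is minimal (its system matrix is irreducible): no realization of the same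
rational matrix has a smaller pencil. -/
def Realization.IsMinimal {ι : Type*} {r : ℕ} (S : Realization ι r) : Prop :=
  ∀ (s : ℕ) (T : Realization ι s), T.transfer = S.transfer → r ≤ s

/-! ### Unimodular and biproper matrices -/

/-- The determinant is a nonzero constant. -/
def IsUnimodular {ι : Type*} [Fintype ι] [DecidableEq ι] (U : Matrix ι ι ℂ[X]) : Prop :=
  ∃ c : ℂ, c ≠ 0 ∧ U.det = Polynomial.C c

/-- `F(λ)` tends to a nonsingular matrix as `λ → ∞`. -/
def IsBiproper {ι : Type*} [Fintype ι] [DecidableEq ι] (F : Matrix ι ι (RatFunc ℂ)) : Prop :=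
  ∃ D : Matrix ι ι ℂ,
    Filter.Tendsto (fun z : ℂ => F.map (fun f => RatFunc.eval (RingHom.id ℂ) z f))
      (Bornology.cobounded ℂ) (nhds D) ∧ D.det ≠ 0

/-! ### Block matrices

Rows and columns of an `mn × mn` matrix are indexed by `Fin m × Fin n`; the pair `(p, a)` is
position `a` inside block `p + 1`. -/

/-- `diag(I_{(m-1)n}, Y)`; this is also the elementary matrix `M_0(Y)`. -/
def elemZero (m : ℕ) {n : ℕ} {R : Type*} [Zero R] [One R] (Y : Matrix (Fin n) (Fin n) R) :
    Matrix (Fin m × Fin n) (Fin m × Fin n) R :=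
  Matrix.comp (Fin m) (Fin m) (Fin n) (Fin n) R <| Matrix.of fun p q =>
    if p = q then (if (p : ℕ) + 1 = m then Y else 1) else 0

/-- The elementary matrix `M_i(Y)` for `1 ≤ i ≤ m - 1`: the identity, except that the
blocks in rows and columns `m - i`, `m - i + 1` are `[Y, I; I, 0]`. -/
def elemPos (m i : ℕ) {n : ℕ} (Y : Matrix (Fin n) (Fin n) ℂ) :
    Matrix (Fin m × Fin n) (Fin m × Fin n) ℂ :=
  Matrix.comp (Fin m) (Fin m) (Fin n) (Fin n) ℂ <| Matrix.of fun p q =>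
    if (p : ℕ) + i + 1 = m ∧ (q : ℕ) + i + 1 = m then Y
    else if (p : ℕ) + i + 1 = m ∧ (q : ℕ) + i = m then 1
    else if (p : ℕ) + i = m ∧ (q : ℕ) + i + 1 = m then 1
    else if (p : ℕ) + i = m ∧ (q : ℕ) + i = m then 0
    else if p = q then 1 else 0

/-- The elementary matrix `M_{-m}(Y) = diag(Y, I_{(m-1)n})`. -/
def elemNegTop (m : ℕ) {n : ℕ} (Y : Matrix (Fin n) (Fin n) ℂ) :
    Matrix (Fin m × Fin n) (Fin m × Fin n) ℂ :=
  Matrix.comp (Fin m) (Fin m) (Fin n) (Fin n) ℂ <| Matrix.of fun p q =>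
    if p = q then (if (p : ℕ) = 0 then Y else 1) else 0

/-- The block column `e_{m-k} ⊗ Y`. -/
def blockCol (m k : ℕ) {n r : ℕ} {R : Type*} [Zero R] (Y : Matrix (Fin n) (Fin r) R) :
    Matrix (Fin m × Fin n) (Fin r) R :=
  Matrix.of fun p b => if (p.1 : ℕ) + k + 1 = m then Y p.2 b else 0

/-- The block row `e_{m-k}^T ⊗ Y`. -/
def blockRow (m k : ℕ) {n r : ℕ} {R : Type*} [Zero R] (Y : Matrix (Fin r) (Fin n) R) :
    Matrix (Fin r) (Fin m × Fin n) R :=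
  Matrix.of fun a q => if (q.1 : ℕ) + k + 1 = m then Y a q.2 else 0

/-- `diag(I_{(m-1)n}, Y)` for an `(n + r) × (n + r)` matrix `Y`: the first `n` rows and columns
of `Y` occupy block `m`. -/
def diagOne (m : ℕ) {n r : ℕ} {R : Type*} [Zero R] [One R]
    (Y : Matrix (Fin n ⊕ Fin r) (Fin n ⊕ Fin r) R) :
    Matrix ((Fin m × Fin n) ⊕ Fin r) ((Fin m × Fin n) ⊕ Fin r) R :=
  Matrix.fromBlocks (elemZero m Y.toBlocks₁₁) (blockCol m 0 Y.toBlocks₁₂)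
    (blockRow m 0 Y.toBlocks₂₁) Y.toBlocks₂₂

/-! ### Rosenbrock strong linearizations -/

/-- `diag(U, U₀) L diag(V, V₀) = diag(I_{(m-1)n}, S(λ))` for some unimodular `U`, `V` and
nonsingular constant `U₀`, `V₀`. -/
def SystemEquivalent {m n r : ℕ} (S : Realization (Fin n) r)
    (L : Matrix ((Fin m × Fin n) ⊕ Fin r) ((Fin m × Fin n) ⊕ Fin r) ℂ[X]) : Prop :=
  ∃ (U V : Matrix (Fin m × Fin n) (Fin m × Fin n) ℂ[X]) (U₀ V₀ : Matrix (Fin r) (Fin r) ℂ),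
    IsUnimodular U ∧ IsUnimodular V ∧ U₀.det ≠ 0 ∧ V₀.det ≠ 0 ∧
    Matrix.fromBlocks U 0 0 (const U₀) * L * Matrix.fromBlocks V 0 0 (const V₀)
      = diagOne m S.systemMatrix

/-- `O_ℓ λ⁻¹ H(λ) O_r = diag(I_{(m-1)n}, λ^{-m} G(λ))` for some biproper `O_ℓ`, `O_r`. -/
def BiproperEquivalent {m n : ℕ} (G : Matrix (Fin n) (Fin n) (RatFunc ℂ))
    (H : Matrix (Fin m × Fin n) (Fin m × Fin n) (RatFunc ℂ)) : Prop :=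
  ∃ Ol Or : Matrix (Fin m × Fin n) (Fin m × Fin n) (RatFunc ℂ),
    IsBiproper Ol ∧ IsBiproper Or ∧
    Ol * ((RatFunc.X : RatFunc ℂ)⁻¹ • H) * Or
      = elemZero m (((RatFunc.X : RatFunc ℂ) ^ m)⁻¹ • G)

/-- `L` is an irreducible system matrix `[𝒳 - λ 𝒴, 𝒞; ℬ, H - λ K]` with `K` nonsingular, and is a
Rosenbrock strong linearization of the rational matrix `G = S.transfer` with system
matrix `S.systemMatrix`. -/
def IsRosenbrockStrongLinearization {m n r : ℕ} (S : Realization (Fin n) r)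
    (L : Matrix ((Fin m × Fin n) ⊕ Fin r) ((Fin m × Fin n) ⊕ Fin r) ℂ[X]) : Prop :=
  ∃ T : Realization (Fin m × Fin n) r,
    (∃ Xc Yc : Matrix (Fin m × Fin n) (Fin m × Fin n) ℂ,
      T.P = const Xc - (X : ℂ[X]) • const Yc) ∧
    L = T.systemMatrix ∧ T.IsMinimal ∧
    SystemEquivalent S L ∧ BiproperEquivalent S.transfer T.transfer

/-! ### Fiedler matrices and Fiedler pencils -/

/-- The Fiedler matrix `M^P_i`, `0 ≤ i ≤ m - 1`, of `P(λ) = ∑ λ^j A_j`. -/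
def fiedlerP {m n : ℕ} (A : Fin (m + 1) → Matrix (Fin n) (Fin n) ℂ) (i : Fin m) :
    Matrix (Fin m × Fin n) (Fin m × Fin n) ℂ :=
  if (i : ℕ) = 0 then elemZero m (-A i.castSucc) else elemPos m i (-A i.castSucc)

/-- The Fiedler matrix `M^P_{-m}`. -/
def fiedlerPNeg {m n : ℕ} (A : Fin (m + 1) → Matrix (Fin n) (Fin n) ℂ) :
    Matrix (Fin m × Fin n) (Fin m × Fin n) ℂ :=
  elemNegTop m (A (Fin.last m))

/-- The Fiedler matrix `𝕄^S_i`, `0 ≤ i ≤ m - 1`, of the system matrix; `A` are the coefficients of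
its polynomial part. -/
def fiedlerS {m n r : ℕ} (A : Fin (m + 1) → Matrix (Fin n) (Fin n) ℂ)
    (S : Realization (Fin n) r) (i : Fin m) :
    Matrix ((Fin m × Fin n) ⊕ Fin r) ((Fin m × Fin n) ⊕ Fin r) ℂ :=
  if (i : ℕ) = 0 then
    Matrix.fromBlocks (fiedlerP A i) (-blockCol m 0 S.C) (-blockRow m 0 S.B) (-S.A)
  else Matrix.fromBlocks (fiedlerP A i) 0 0 1

/-- The Fiedler matrix `𝕄^S_{-m}`. -/
def fiedlerSNeg {m n r : ℕ} (A : Fin (m + 1) → Matrix (Fin n) (Fin n) ℂ)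
    (S : Realization (Fin n) r) :
    Matrix ((Fin m × Fin n) ⊕ Fin r) ((Fin m × Fin n) ⊕ Fin r) ℂ :=
  Matrix.fromBlocks (fiedlerPNeg A) 0 0 (-S.E)

/-- The Fiedler pencil `λ M^P_{-m} - M^P_σ` of `P(λ)`; the permutation `σ` is read as the index
tuple `(σ 0, σ 1, …, σ (m-1))`, and `M^P_σ` is the product in this order. -/
def pencilP {m n : ℕ} (A : Fin (m + 1) → Matrix (Fin n) (Fin n) ℂ) (σ : Equiv.Perm (Fin m)) :
    Matrix (Fin m × Fin n) (Fin m × Fin n) ℂ[X] :=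
  (X : ℂ[X]) • const (fiedlerPNeg A) - const (List.ofFn fun k => fiedlerP A (σ k)).prod

/-- The Fiedler pencil `λ 𝕄^S_{-m} - 𝕄^S_σ`. -/
def pencilS {m n r : ℕ} (A : Fin (m + 1) → Matrix (Fin n) (Fin n) ℂ)
    (S : Realization (Fin n) r) (σ : Equiv.Perm (Fin m)) :
    Matrix ((Fin m × Fin n) ⊕ Fin r) ((Fin m × Fin n) ⊕ Fin r) ℂ[X] :=
  (X : ℂ[X]) • const (fiedlerSNeg A S) - const (List.ofFn fun k => fiedlerS A S (σ k)).prod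

/-! ### Consecutions and inversions -/

/-- The index tuple of a permutation of `{0, …, m-1}`. -/
def tuple {m : ℕ} (σ : Equiv.Perm (Fin m)) : List ℕ := List.ofFn fun k => (σ k : ℕ)

/-- `α` has `p` consecutive consecutions at `t`, i.e. `c_t(α) = p`: `(t, …, t+p)` is a subtuple
of `α` and `(t, …, t+p+1)` is not. -/
def HasConsecutions (α : List ℕ) (t p : ℕ) : Prop :=
  (List.range' t (p + 1)).Sublist α ∧ ¬ (List.range' t (p + 2)).Sublist α

/-- `α` has `s` consecutive inversions at `t`, i.e. `i_t(α) = s`: `(t+s, …, t)` is a subtuple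
of `α` and `(t+s+1, …, t)` is not. -/
def HasInversions (α : List ℕ) (t s : ℕ) : Prop :=
  (List.range' t (s + 1)).reverse.Sublist α ∧ ¬ (List.range' t (s + 2)).reverse.Sublist α

end

end Fiedler

/-!
Over a commutative ring, consider the homogeneous Fiedler pencil `s M_{-m} - t M_σ` with `s` and `t`
coprime. The Fiedler matrix of largest index commutes with all the others except its predecessor,
so it can be moved to one end of the product and eliminated; by induction the pencil is equivalent
to `diag(I, s^m A_m + s^(m-1) t A_{m-1} + ⋯ + t^m A_0)`. Over the polynomials, `s = λ` and `t = 1`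
give unimodular transformations; over the proper rational functions, `s = 1` and `t = λ⁻¹` give
biproper ones.

When `t` is a unit the transformations do not depend on `A_0`. Replacing `A_0` by `A_0 + Z` adds to
the pencil the term `t (e_{m-i₀} ⊗ I) Z (e_{m-c₀}ᵀ ⊗ I)` and to the reduced form a multiple of `Z`
in the last block; for `t = 1` the transformations therefore move the blocks `C` and `B` to where
they belong, up to mutually inverse factors that can be absorbed. Likewise `G(λ)` and `𝔾(λ)` are
`P(λ)` and `L_σ(λ)` with `A_0` replaced by `A_0 + C (λ E - A)⁻¹ B`, which is proper. Finally,
multiplying a rational matrix by matrix polynomials on both sides does not increase its state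
dimension, and `G(λ)` arises in this way from `𝔾(λ)`; hence `𝔾(λ)` has no realization of dimension
smaller than `r`.
-/

namespace Fiedler

open scoped Matrix

noncomputable section

/-! ### Fiedler matrices over a commutative ring -/

section ExtendByOne

variable {ι ν κ R S : Type*} [DecidableEq ι] [Fintype ν] [DecidableEq ν] [CommRing R] [CommRing S]

/-- For `p * q = 1`, the matrix acting as `Y` on the image of `q` and as the identity on the kernel
of `p`. -/
def extendByOne (q : Matrix ι ν R) (p : Matrix ν ι R) (Y : Matrix ν ν R) : Matrix ι ι R :=
  1 + q * (Y - 1) * p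

theorem extendByOne_one (q : Matrix ι ν R) (p : Matrix ν ι R) : extendByOne q p 1 = 1 := by
  simp [extendByOne]

theorem extendByOne_eq_add (q : Matrix ι ν R) (p : Matrix ν ι R) (Y : Matrix ν ν R) :
    extendByOne q p Y = extendByOne q p 0 + q * Y * p := by
  simp only [extendByOne, Matrix.mul_sub, Matrix.sub_mul, Matrix.mul_zero, Matrix.zero_mul]
  abel

theorem extendByOne_transpose (q : Matrix ι ν R) (p : Matrix ν ι R) (Y : Matrix ν ν R) :
    (extendByOne q p Y)ᵀ = extendByOne pᵀ qᵀ Yᵀ := by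
  simp [extendByOne, Matrix.mul_assoc]

theorem extendByOne_map (φ : R →+* S) (q : Matrix ι ν R) (p : Matrix ν ι R) (Y : Matrix ν ν R) :
    (extendByOne q p Y).map φ = extendByOne (q.map φ) (p.map φ) (Y.map φ) := by
  simp [extendByOne, Matrix.map_add, Matrix.map_mul, Matrix.map_sub, Matrix.map_one]

variable [Fintype ι] {q : Matrix ι ν R} {p : Matrix ν ι R}

theorem extendByOne_mul_col (hpq : p * q = 1) (Y : Matrix ν ν R) :
    extendByOne q p Y * q = q * Y := by
  simp [extendByOne, Matrix.add_mul, Matrix.mul_assoc, hpq, Matrix.mul_sub]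

theorem row_mul_extendByOne (hpq : p * q = 1) (Y : Matrix ν ν R) :
    p * extendByOne q p Y = Y * p := by
  simp [extendByOne, Matrix.mul_add, ← Matrix.mul_assoc, hpq, Matrix.sub_mul]

theorem extendByOne_mul (hpq : p * q = 1) (Y Z : Matrix ν ν R) :
    extendByOne q p Y * extendByOne q p Z = extendByOne q p (Y * Z) := by
  rw [extendByOne.eq_1 q p Z, mul_add, ← Matrix.mul_assoc, ← Matrix.mul_assoc,
    extendByOne_mul_col hpq]
  simp only [extendByOne, mul_one, Matrix.mul_sub, Matrix.sub_mul, Matrix.mul_assoc]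
  abel

theorem extendByOne_mul_of_row_mul_eq_zero {M : Matrix ι κ R} (hM : p * M = 0)
    (Y : Matrix ν ν R) : extendByOne q p Y * M = M := by
  simp [extendByOne, Matrix.add_mul, Matrix.mul_assoc, hM]

end ExtendByOne

section Units

variable (R : Type*) {S : Type*} [CommRing R] [CommRing S] (n : ℕ) {m : ℕ}

variable (m) in
/-- The block column `e_{m-k} ⊗ I_n`. -/
def unitCol (k : ℕ) : Matrix (Fin m × Fin n) (Fin n) R := blockCol m k 1

variable (m) in
/-- The block row `e_{m-k}ᵀ ⊗ I_n`. -/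
def unitRow (k : ℕ) : Matrix (Fin n) (Fin m × Fin n) R := blockRow m k 1

theorem unitCol_transpose (k : ℕ) : (unitCol R n m k)ᵀ = unitRow R n m k := by
  ext a ⟨p, b⟩
  simp [unitCol, unitRow, blockCol, blockRow, Matrix.one_apply, eq_comm]

theorem unitRow_transpose (k : ℕ) : (unitRow R n m k)ᵀ = unitCol R n m k := by
  rw [← unitCol_transpose, Matrix.transpose_transpose]

variable {R} in
theorem unitCol_map (φ : R →+* S) (k : ℕ) : (unitCol R n m k).map φ = unitCol S n m k := by
  ext
  simp [unitCol, blockCol, Matrix.one_apply, apply_ite φ]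

variable {R} in
theorem unitRow_map (φ : R →+* S) (k : ℕ) : (unitRow R n m k).map φ = unitRow S n m k := by
  rw [← unitCol_transpose, Matrix.transpose_map, unitCol_map, unitCol_transpose]

theorem unitRow_mul_unitCol (j : ℕ) {k : ℕ} (hk : k < m) :
    unitRow R n m j * unitCol R n m k = if j = k then 1 else 0 := by
  ext a b
  simp only [unitRow, unitCol, blockRow, blockCol, Matrix.mul_apply, Fintype.sum_prod_type,
    Matrix.of_apply, Matrix.one_apply, mul_ite, mul_zero, mul_one]
  rw [Finset.sum_eq_single_of_mem (⟨m - 1 - k, by lia⟩ : Fin m) (Finset.mem_univ _)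
    fun p _ hp ↦ by simp [show (p : ℕ) + k + 1 ≠ m by grind]]
  split_ifs with hjk <;> simp [Matrix.one_apply] <;> grind

theorem unitRow_mul_unitCol_self {k : ℕ} (hk : k < m) :
    unitRow R n m k * unitCol R n m k = 1 := by
  rw [unitRow_mul_unitCol R n k hk, if_pos rfl]

variable {R n}

theorem unitCol_mul_apply {κ : Type*} (k : ℕ) (Y : Matrix (Fin n) κ R) (p : Fin m × Fin n)
    (b : κ) : (unitCol R n m k * Y) p b = if (p.1 : ℕ) + k + 1 = m then Y p.2 b else 0 := by
  split_ifs with hp <;> simp [unitCol, blockCol, Matrix.mul_apply, Matrix.one_apply, hp]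

theorem mul_unitRow_apply {κ : Type*} (k : ℕ) (Y : Matrix κ (Fin n) R) (a : κ)
    (q : Fin m × Fin n) :
    (Y * unitRow R n m k) a q = if (q.1 : ℕ) + k + 1 = m then Y a q.2 else 0 := by
  split_ifs with hq <;> simp [unitRow, blockRow, Matrix.mul_apply, Matrix.one_apply, hq]

theorem unitCol_mul {r : ℕ} (k : ℕ) (Y : Matrix (Fin n) (Fin r) R) :
    unitCol R n m k * Y = blockCol m k Y :=
  Matrix.ext (unitCol_mul_apply k Y)

theorem mul_unitRow {r : ℕ} (k : ℕ) (Y : Matrix (Fin r) (Fin n) R) :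
    Y * unitRow R n m k = blockRow m k Y :=
  Matrix.ext (mul_unitRow_apply k Y)

theorem extendByOne_unitCol_apply (k : ℕ) (Y : Matrix (Fin n) (Fin n) R) (p q : Fin m)
    (a b : Fin n) :
    extendByOne (unitCol R n m k) (unitRow R n m k) Y (p, a) (q, b) =
      if p = q then (if (p : ℕ) + k + 1 = m then Y else 1) a b else 0 := by
  simp only [extendByOne, Matrix.add_apply, mul_unitRow_apply, unitCol_mul_apply,
    Matrix.sub_apply, Matrix.one_apply, Prod.mk.injEq]
  by_cases hpq : p = q <;> by_cases hp : (p : ℕ) + k + 1 = m <;> by_cases hq : (q : ℕ) + k + 1 = m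
  all_goals first | (exfalso; lia) | simp [hpq, hp, hq, Matrix.one_apply]

theorem elemZero_eq_extendByOne (Y : Matrix (Fin n) (Fin n) R) :
    elemZero m Y = extendByOne (unitCol R n m 0) (unitRow R n m 0) Y := by
  ext ⟨p, a⟩ ⟨q, b⟩
  rw [extendByOne_unitCol_apply]
  simp only [elemZero, Matrix.comp_apply, Matrix.of_apply, add_zero]
  split_ifs <;> rfl

variable (m) in
/-- The matrix `M_{-m}(Y) = diag(Y, I_{(m-1)n})` over an arbitrary ring. -/
def leadBlock (Y : Matrix (Fin n) (Fin n) R) : Matrix (Fin m × Fin n) (Fin m × Fin n) R :=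
  extendByOne (unitCol R n m (m - 1)) (unitRow R n m (m - 1)) Y

theorem elemNegTop_eq_leadBlock (Y : Matrix (Fin n) (Fin n) ℂ) :
    elemNegTop m Y = leadBlock m Y := by
  ext ⟨p, a⟩ ⟨q, b⟩
  rw [leadBlock, extendByOne_unitCol_apply]
  simp only [elemNegTop, Matrix.comp_apply, Matrix.of_apply,
    show (p : ℕ) + (m - 1) + 1 = m ↔ (p : ℕ) = 0 by lia]
  split_ifs <;> rfl

variable (m) in
/-- The matrix `M_{i+1}(Y)` over an arbitrary ring. -/
def elemSucc (i : ℕ) (Y : Matrix (Fin n) (Fin n) R) : Matrix (Fin m × Fin n) (Fin m × Fin n) R :=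
  1 + unitCol R n m (i + 1) * (Y - 1) * unitRow R n m (i + 1)
    + unitCol R n m (i + 1) * unitRow R n m i + unitCol R n m i * unitRow R n m (i + 1)
    - unitCol R n m i * unitRow R n m i

theorem elemPos_succ_eq_elemSucc {i : ℕ} (Y : Matrix (Fin n) (Fin n) ℂ) :
    elemPos m (i + 1) Y = elemSucc m i Y := by
  have unit_apply (j k : ℕ) (p q : Fin m) (a b : Fin n) :
      (unitCol ℂ n m j * unitRow ℂ n m k) (p, a) (q, b) =
        if (q : ℕ) + k + 1 = m ∧ (p : ℕ) + j + 1 = m ∧ a = b then 1 else 0 := by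
    simp only [mul_unitRow_apply, unitCol, blockCol, Matrix.of_apply, Matrix.one_apply, ite_and]
  ext ⟨p, a⟩ ⟨q, b⟩
  simp only [elemPos, elemSucc, Matrix.comp_apply, Matrix.of_apply, Matrix.add_apply,
    Matrix.sub_apply, mul_unitRow_apply, unitCol_mul_apply, unit_apply, Matrix.one_apply,
    Prod.mk.injEq, Fin.ext_iff]
  by_cases hpq : (p : ℕ) = q <;>
    by_cases hp : (p : ℕ) + (i + 1) = m <;> by_cases hp' : (p : ℕ) + (i + 2) = m <;>
    by_cases hq : (q : ℕ) + (i + 1) = m <;> by_cases hq' : (q : ℕ) + (i + 2) = m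
  all_goals first
    | (exfalso; lia)
    | simp [add_assoc, one_add_one_eq_two, hpq, hp, hp', hq, hq', Matrix.one_apply, Fin.ext_iff]

theorem elemSucc_transpose (i : ℕ) (Y : Matrix (Fin n) (Fin n) R) :
    (elemSucc m i Y)ᵀ = elemSucc m i Yᵀ := by
  simp only [elemSucc, Matrix.transpose_add, Matrix.transpose_sub, Matrix.transpose_mul,
    Matrix.transpose_one, unitCol_transpose, unitRow_transpose, Matrix.mul_assoc]
  abel

theorem elemSucc_map (φ : R →+* S) (i : ℕ) (Y : Matrix (Fin n) (Fin n) R) :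
    (elemSucc m i Y).map φ = elemSucc m i (Y.map φ) := by
  simp [elemSucc, Matrix.map_add, Matrix.map_sub, Matrix.map_mul, unitCol_map, unitRow_map]

theorem elemSucc_mul_unitCol_of_ne {i k : ℕ} (hk : k < m) (hki : k ≠ i) (hki' : k ≠ i + 1)
    (Y : Matrix (Fin n) (Fin n) R) : elemSucc m i Y * unitCol R n m k = unitCol R n m k := by
  simp [elemSucc, Matrix.add_mul, Matrix.sub_mul, Matrix.mul_assoc, unitRow_mul_unitCol R n _ hk,
    hki.symm, hki'.symm]

theorem elemSucc_mul_unitCol {i : ℕ} (hi : i < m) (Y : Matrix (Fin n) (Fin n) R) :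
    elemSucc m i Y * unitCol R n m i = unitCol R n m (i + 1) := by
  simp [elemSucc, Matrix.add_mul, Matrix.sub_mul, Matrix.mul_assoc, unitRow_mul_unitCol R n _ hi]

end Units

section FiedlerProduct

variable {R S : Type*} [CommRing R] [CommRing S] {m n : ℕ}

variable (m) in
/-- The Fiedler matrices over an arbitrary ring. The constant coefficient `A₀` is kept apart, and
`A i` is the coefficient of `λ^(i+1)`. -/
def fiedlerFactor (A₀ : Matrix (Fin n) (Fin n) R) (A : ℕ → Matrix (Fin n) (Fin n) R) :
    ℕ → Matrix (Fin m × Fin n) (Fin m × Fin n) R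
  | 0 => elemZero m (-A₀)
  | i + 1 => elemSucc m i (-A i)

variable (m) in
/-- The product of the Fiedler matrices with the indices in a list. -/
def fiedlerProd (A₀ : Matrix (Fin n) (Fin n) R) (A : ℕ → Matrix (Fin n) (Fin n) R) (l : List ℕ) :
    Matrix (Fin m × Fin n) (Fin m × Fin n) R :=
  (l.map (fiedlerFactor m A₀ A)).prod

variable (A₀ : Matrix (Fin n) (Fin n) R) (A : ℕ → Matrix (Fin n) (Fin n) R)

theorem fiedlerFactor_transpose (i : ℕ) :
    (fiedlerFactor m A₀ A i)ᵀ = fiedlerFactor m A₀ᵀ (fun j ↦ (A j)ᵀ) i := by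
  cases i with
  | zero => simp [fiedlerFactor, elemZero_eq_extendByOne, extendByOne_transpose,
      unitRow_transpose, unitCol_transpose]
  | succ i => simp [fiedlerFactor, elemSucc_transpose]

theorem fiedlerFactor_map (φ : R →+* S) (i : ℕ) :
    (fiedlerFactor m A₀ A i).map φ = fiedlerFactor m (A₀.map φ) (fun j ↦ (A j).map φ) i := by
  cases i with
  | zero => simp [fiedlerFactor, elemZero_eq_extendByOne, extendByOne_map, unitRow_map,
      unitCol_map, Matrix.map_neg]
  | succ i => simp [fiedlerFactor, elemSucc_map, Matrix.map_neg]

theorem fiedlerProd_cons (i : ℕ) (l : List ℕ) :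
    fiedlerProd m A₀ A (i :: l) = fiedlerFactor m A₀ A i * fiedlerProd m A₀ A l :=
  List.prod_cons

theorem fiedlerProd_append (l₁ l₂ : List ℕ) :
    fiedlerProd m A₀ A (l₁ ++ l₂) = fiedlerProd m A₀ A l₁ * fiedlerProd m A₀ A l₂ := by
  simp [fiedlerProd]

theorem fiedlerProd_transpose (l : List ℕ) :
    (fiedlerProd m A₀ A l)ᵀ = fiedlerProd m A₀ᵀ (fun j ↦ (A j)ᵀ) l.reverse := by
  simp [fiedlerProd, Matrix.transpose_list_prod, Function.comp_def, fiedlerFactor_transpose]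

theorem fiedlerProd_map (φ : R →+* S) (l : List ℕ) :
    (fiedlerProd m A₀ A l).map φ = fiedlerProd m (A₀.map φ) (fun j ↦ (A j).map φ) l := by
  simp only [fiedlerProd, ← RingHom.mapMatrix_apply, map_list_prod, List.map_map,
    Function.comp_def]
  simp only [RingHom.mapMatrix_apply, fiedlerFactor_map]

variable {A₀} in
theorem fiedlerProd_congr_of_notMem (A₀' : Matrix (Fin n) (Fin n) R) {l : List ℕ} (hl : 0 ∉ l) :
    fiedlerProd m A₀ A l = fiedlerProd m A₀' A l := by
  refine congrArg List.prod (List.map_congr_left fun i hi ↦ ?_)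
  cases i with
  | zero => exact absurd hi hl
  | succ i => rfl

theorem fiedlerFactor_mul_unitCol_of_ne {i k : ℕ} (hk : k < m) (hik : i ≠ k) (hik' : i ≠ k + 1) :
    fiedlerFactor m A₀ A i * unitCol R n m k = unitCol R n m k := by
  cases i with
  | zero =>
    rw [fiedlerFactor, elemZero_eq_extendByOne]
    exact extendByOne_mul_of_row_mul_eq_zero (by simp [unitRow_mul_unitCol R n 0 hk, hik]) _
  | succ i => exact elemSucc_mul_unitCol_of_ne hk (by lia) hik.symm _

theorem unitRow_mul_fiedlerFactor_of_ne {i k : ℕ} (hk : k < m) (hik : i ≠ k) (hik' : i ≠ k + 1) :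
    unitRow R n m k * fiedlerFactor m A₀ A i = unitRow R n m k := by
  apply Matrix.transpose_injective
  rw [Matrix.transpose_mul, fiedlerFactor_transpose, unitRow_transpose,
    fiedlerFactor_mul_unitCol_of_ne _ _ hk hik hik']

theorem commute_elemSucc {M : Matrix (Fin m × Fin n) (Fin m × Fin n) R} {i : ℕ}
    (Y : Matrix (Fin n) (Fin n) R)
    (hu : M * unitCol R n m i = unitCol R n m i)
    (hu' : M * unitCol R n m (i + 1) = unitCol R n m (i + 1))
    (hv : unitRow R n m i * M = unitRow R n m i)
    (hv' : unitRow R n m (i + 1) * M = unitRow R n m (i + 1)) :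
    Commute (elemSucc m i Y) M := by
  simp only [Commute, SemiconjBy, elemSucc, add_mul, sub_mul, mul_add, mul_sub, Matrix.mul_assoc,
    hv, hv', one_mul, mul_one]
  simp only [← Matrix.mul_assoc, hu, hu']

theorem commute_elemSucc_fiedlerProd {i : ℕ} (Y : Matrix (Fin n) (Fin n) R) {l : List ℕ}
    (hl : ∀ j ∈ l, j < i) : Commute (elemSucc (i + 2) i Y) (fiedlerProd (i + 2) A₀ A l) := by
  refine Commute.list_prod_right _ _ fun M hM ↦ ?_
  obtain ⟨j, hj, rfl⟩ := List.mem_map.1 hM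
  have := hl j hj
  apply commute_elemSucc
  · exact fiedlerFactor_mul_unitCol_of_ne _ _ (by lia) (by lia) (by lia)
  · exact fiedlerFactor_mul_unitCol_of_ne _ _ (by lia) (by lia) (by lia)
  · exact unitRow_mul_fiedlerFactor_of_ne _ _ (by lia) (by lia) (by lia)
  · exact unitRow_mul_fiedlerFactor_of_ne _ _ (by lia) (by lia) (by lia)

end FiedlerProduct

section FirstBlock

variable {R : Type*} [CommRing R] {n : ℕ}

/-- Separates the first block from the others. -/
def splitFirst (k n : ℕ) : Fin (k + 1) × Fin n ≃ Fin n ⊕ Fin k × Fin n :=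
  ((finSuccEquiv k).prodCongr (.refl _)).trans optionProdEquiv

/-- Assembles an `n(k+1) × n(k+1)` matrix from its first block row and column and the rest. -/
def assemble (k : ℕ) : Matrix (Fin n ⊕ Fin k × Fin n) (Fin n ⊕ Fin k × Fin n) R ≃ₐ[R]
    Matrix (Fin (k + 1) × Fin n) (Fin (k + 1) × Fin n) R :=
  Matrix.reindexAlgEquiv R R (splitFirst k n).symm

theorem det_assemble {k : ℕ} (M : Matrix (Fin n ⊕ Fin k × Fin n) (Fin n ⊕ Fin k × Fin n) R) :
    (assemble k M).det = M.det :=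
  Matrix.det_reindexAlgEquiv R R _ M

theorem fromBlocks_sub {ι κ μ ν : Type*} (A A' : Matrix ι μ R) (B B' : Matrix ι ν R)
    (C C' : Matrix κ μ R) (D D' : Matrix κ ν R) :
    Matrix.fromBlocks A B C D - Matrix.fromBlocks A' B' C' D' =
      Matrix.fromBlocks (A - A') (B - B') (C - C') (D - D') := by
  simp only [sub_eq_add_neg, Matrix.fromBlocks_neg, Matrix.fromBlocks_add]

theorem unitCol_self_eq_zero (k : ℕ) : unitCol R n k k = 0 := by
  ext ⟨p, a⟩ b
  simp [unitCol, blockCol, show (p : ℕ) + k + 1 ≠ k by lia]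

theorem unitRow_self_eq_zero (k : ℕ) : unitRow R n k k = 0 := by
  rw [← unitCol_transpose, unitCol_self_eq_zero, Matrix.transpose_zero]

theorem unitCol_mul_mul_unitRow_eq_assemble {k i j : ℕ} (Y : Matrix (Fin n) (Fin n) R) :
    unitCol R n (k + 1) i * Y * unitRow R n (k + 1) j =
      assemble k (Matrix.fromBlocks
        (if i = k ∧ j = k then Y else 0) (if i = k then Y * unitRow R n k j else 0)
        (if j = k then unitCol R n k i * Y else 0) (unitCol R n k i * Y * unitRow R n k j)) := by
  ext ⟨p, a⟩ ⟨q, b⟩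
  rw [mul_unitRow_apply, unitCol_mul_apply, assemble, Matrix.coe_reindexAlgEquiv,
    Matrix.reindex_apply, Matrix.submatrix_apply, Equiv.symm_symm]
  rcases Fin.eq_zero_or_eq_succ p with rfl | ⟨p, rfl⟩ <;>
    rcases Fin.eq_zero_or_eq_succ q with rfl | ⟨q, rfl⟩ <;>
    by_cases hi : i = k <;> by_cases hj : j = k <;>
    simp [splitFirst, mul_unitRow_apply, unitCol_mul_apply, hi, hj, add_right_comm _ 1]

theorem unitCol_mul_unitRow_eq_assemble {k i j : ℕ} :
    unitCol R n (k + 1) i * unitRow R n (k + 1) j =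
      assemble k (Matrix.fromBlocks
        (if i = k ∧ j = k then 1 else 0) (if i = k then unitRow R n k j else 0)
        (if j = k then unitCol R n k i else 0) (unitCol R n k i * unitRow R n k j)) := by
  simpa only [Matrix.mul_one, Matrix.one_mul] using
    unitCol_mul_mul_unitRow_eq_assemble (R := R) (i := i) (j := j) 1

theorem extendByOne_unitCol_eq_assemble {k i : ℕ} (hi : i < k) (Y : Matrix (Fin n) (Fin n) R) :
    extendByOne (unitCol R n (k + 1) i) (unitRow R n (k + 1) i) Y =
      assemble k (Matrix.fromBlocks 1 0 0
        (extendByOne (unitCol R n k i) (unitRow R n k i) Y)) := by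
  rw [extendByOne, extendByOne, unitCol_mul_mul_unitRow_eq_assemble, ← map_one (assemble k),
    ← map_add, ← Matrix.fromBlocks_one, Matrix.fromBlocks_add]
  simp [hi.ne]

theorem leadBlock_eq_assemble {k : ℕ} (Y : Matrix (Fin n) (Fin n) R) :
    leadBlock (k + 1) Y = assemble k (Matrix.fromBlocks Y 0 0 1) := by
  rw [leadBlock, Nat.add_sub_cancel, extendByOne, unitCol_mul_mul_unitRow_eq_assemble,
    ← map_one (assemble k), ← map_add, ← Matrix.fromBlocks_one, Matrix.fromBlocks_add]
  simp [unitCol_self_eq_zero, unitRow_self_eq_zero]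

theorem fiedlerFactor_succ_eq_assemble {k : ℕ} (A₀ : Matrix (Fin n) (Fin n) R)
    (A : ℕ → Matrix (Fin n) (Fin n) R) {i : ℕ} (hi : i < k) :
    fiedlerFactor (k + 1) A₀ A i =
      assemble k (Matrix.fromBlocks 1 0 0 (fiedlerFactor k A₀ A i)) := by
  cases i with
  | zero => simp only [fiedlerFactor, elemZero_eq_extendByOne, extendByOne_unitCol_eq_assemble hi]
  | succ i =>
    rw [fiedlerFactor, fiedlerFactor, elemSucc, elemSucc, ← map_one (assemble k)]
    simp only [unitCol_mul_mul_unitRow_eq_assemble, unitCol_mul_unitRow_eq_assemble, ← map_add,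
      ← map_sub, ← Matrix.fromBlocks_one, Matrix.fromBlocks_add, fromBlocks_sub]
    simp [hi.ne, (Nat.lt_of_succ_lt hi).ne]

/-- The Fiedler matrix of largest index, with respect to the splitting into the first block and
the others; there `q` and `p` are the unit block column and row of the next block. -/
def topFiedler {ι ν : Type*} [DecidableEq ι] [Fintype ν] [DecidableEq ν]
    (q : Matrix ι ν R) (p : Matrix ν ι R) (a : Matrix ν ν R) : Matrix (ν ⊕ ι) (ν ⊕ ι) R :=
  Matrix.fromBlocks (-a) p q (extendByOne q p 0)

theorem elemSucc_eq_assemble_topFiedler {k : ℕ} (a : Matrix (Fin n) (Fin n) R) :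
    elemSucc (k + 2) k (-a) =
      assemble (k + 1) (topFiedler (unitCol R n (k + 1) k) (unitRow R n (k + 1) k) a) := by
  rw [elemSucc, ← map_one (assemble (k + 1))]
  simp only [unitCol_mul_mul_unitRow_eq_assemble (k := k + 1),
    unitCol_mul_unitRow_eq_assemble (k := k + 1), ← map_add, ← map_sub,
    ← Matrix.fromBlocks_one, Matrix.fromBlocks_add, fromBlocks_sub]
  simp [topFiedler, extendByOne, unitCol_self_eq_zero, unitRow_self_eq_zero, sub_eq_add_neg]

theorem fiedlerProd_succ_eq_assemble {k : ℕ} (A₀ : Matrix (Fin n) (Fin n) R)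
    (A : ℕ → Matrix (Fin n) (Fin n) R) {l : List ℕ} (hl : ∀ i ∈ l, i < k) :
    fiedlerProd (k + 1) A₀ A l =
      assemble k (Matrix.fromBlocks 1 0 0 (fiedlerProd k A₀ A l)) := by
  induction l with
  | nil => simp [fiedlerProd]
  | cons i l ih =>
    rw [fiedlerProd_cons, fiedlerProd_cons, ih fun j hj ↦ hl j (List.mem_cons_of_mem _ hj),
      fiedlerFactor_succ_eq_assemble _ _ (hl i List.mem_cons_self), ← map_mul,
      Matrix.fromBlocks_multiply]
    simp

/-- The Fiedler matrix of largest index can be moved to one end, because it commutes with all the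
others except its predecessor. -/
theorem exists_fiedlerProd_eq_assemble {k : ℕ} {l : List ℕ} (hl : l.Perm (List.range (k + 2))) :
    ∃ l' : List ℕ, l'.Perm (List.range (k + 1)) ∧
      ((∀ (A₀ : Matrix (Fin n) (Fin n) R) (A : ℕ → Matrix (Fin n) (Fin n) R),
        fiedlerProd (k + 2) A₀ A l = assemble (k + 1)
          (topFiedler (unitCol R n (k + 1) k) (unitRow R n (k + 1) k) (A k) *
            Matrix.fromBlocks 1 0 0 (fiedlerProd (k + 1) A₀ A l'))) ∨
      (∀ (A₀ : Matrix (Fin n) (Fin n) R) (A : ℕ → Matrix (Fin n) (Fin n) R),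
        fiedlerProd (k + 2) A₀ A l = assemble (k + 1)
          (Matrix.fromBlocks 1 0 0 (fiedlerProd (k + 1) A₀ A l') *
            topFiedler (unitCol R n (k + 1) k) (unitRow R n (k + 1) k) (A k)))) := by
  obtain ⟨l₁, l₂, rfl⟩ := List.append_of_mem (hl.mem_iff.2 (List.mem_range.2 (Nat.lt_succ_self _)))
  have hp : (l₁ ++ l₂).Perm (List.range (k + 1)) := by
    refine (List.Perm.trans (List.perm_middle.symm.trans hl) ?_).cons_inv
    rw [List.range_succ]
    exact List.perm_append_comm
  have hlt : ∀ i ∈ l₁ ++ l₂, i < k + 1 := fun i hi ↦ List.mem_range.1 (hp.mem_iff.1 hi)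
  have hdisj := List.disjoint_of_nodup_append (hp.nodup_iff.2 List.nodup_range)
  refine ⟨l₁ ++ l₂, hp, ?_⟩
  simp only [map_mul, ← elemSucc_eq_assemble_topFiedler, ← fiedlerProd_succ_eq_assemble _ _ hlt]
  simp only [fiedlerProd_append, fiedlerProd_cons, fiedlerFactor]
  rcases List.mem_append.1 (hp.mem_iff.2 List.self_mem_range_succ) with hk | hk
  · refine .inr fun A₀ A ↦ ?_
    rw [(commute_elemSucc_fiedlerProd A₀ A _ fun j hj ↦ ?_).eq, mul_assoc]
    have := hlt j (List.mem_append_right _ hj)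
    have := ne_of_mem_of_not_mem hj (hdisj hk)
    lia
  · refine .inl fun A₀ A ↦ ?_
    rw [← mul_assoc, ← (commute_elemSucc_fiedlerProd A₀ A _ fun j hj ↦ ?_).eq, mul_assoc]
    have := hlt j (List.mem_append_left _ hj)
    have := ne_of_mem_of_not_mem hj (hdisj.symm hk)
    lia

end FirstBlock

/-! ### Stripping off one Fiedler factor -/

section UniformEquivalence

variable {ω ω' ι κ R : Type*} [Fintype ι] [DecidableEq ι] [Fintype κ] [DecidableEq κ] [CommRing R]
  {c c' : Prop} {F G H : ω → Matrix ι ι R}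

/-- The matrices `F w` and `G w` are equivalent for every parameter `w`; if `c` holds, then by
transformations that do not depend on `w`. -/
def UniformlyEquivalent (c : Prop) (F G : ω → Matrix ι ι R) : Prop :=
  ∃ U V : ω → Matrix ι ι R,
    (∀ w, IsUnit (U w).det ∧ IsUnit (V w).det ∧ U w * F w * V w = G w) ∧
    (c → ∀ w w', U w = U w' ∧ V w = V w')

namespace UniformlyEquivalent

theorem refl (c : Prop) (F : ω → Matrix ι ι R) : UniformlyEquivalent c F F :=
  ⟨1, 1, by simp, by simp⟩

theorem trans (hFG : UniformlyEquivalent c F G) (hGH : UniformlyEquivalent c G H) :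
    UniformlyEquivalent c F H := by
  obtain ⟨U, V, hUV, hc⟩ := hFG
  obtain ⟨U', V', hUV', hc'⟩ := hGH
  refine ⟨fun w ↦ U' w * U w, fun w ↦ V w * V' w, fun w ↦ ?_, fun h w w' ↦ ?_⟩
  · obtain ⟨hU, hV, h⟩ := hUV w
    obtain ⟨hU', hV', h'⟩ := hUV' w
    refine ⟨by simpa using hU'.mul hU, by simpa using hV.mul hV', ?_⟩
    rw [← h', ← h]
    noncomm_ring
  · simp only [hc h w w', hc' h w w', and_self]

theorem mono (hFG : UniformlyEquivalent c F G) (hc : c' → c) : UniformlyEquivalent c' F G := by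
  obtain ⟨U, V, hUV, h⟩ := hFG
  exact ⟨U, V, hUV, h ∘ hc⟩

theorem comp (hFG : UniformlyEquivalent c F G) (f : ω' → ω) :
    UniformlyEquivalent c (F ∘ f) (G ∘ f) := by
  obtain ⟨U, V, hUV, hc⟩ := hFG
  exact ⟨U ∘ f, V ∘ f, fun w ↦ hUV (f w), fun h w w' ↦ hc h (f w) (f w')⟩

theorem transpose (hFG : UniformlyEquivalent c F G) :
    UniformlyEquivalent c (fun w ↦ (F w)ᵀ) (fun w ↦ (G w)ᵀ) := by
  obtain ⟨U, V, hUV, hc⟩ := hFG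
  refine ⟨fun w ↦ (V w)ᵀ, fun w ↦ (U w)ᵀ, fun w ↦ ?_, fun h w w' ↦ ?_⟩
  · obtain ⟨hU, hV, h⟩ := hUV w
    simp [hU, hV, ← h, Matrix.mul_assoc]
  · simp only [hc h w w', and_self]

theorem map (hFG : UniformlyEquivalent c F G) (f : Matrix ι ι R → Matrix κ κ R)
    (hmul : ∀ M N, f (M * N) = f M * f N) (hdet : ∀ M, (f M).det = M.det) :
    UniformlyEquivalent c (fun w ↦ f (F w)) (fun w ↦ f (G w)) := by
  obtain ⟨U, V, hUV, hc⟩ := hFG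
  refine ⟨fun w ↦ f (U w), fun w ↦ f (V w), fun w ↦ ?_, fun h w w' ↦ ?_⟩
  · obtain ⟨hU, hV, h⟩ := hUV w
    simp only [hdet, hU, hV, ← h, hmul, and_self]
  · simp only [hc h w w', and_self]

end UniformlyEquivalent

end UniformEquivalence

section ReductionStep

variable {ι ν R : Type*} [Fintype ι] [DecidableEq ι] [Fintype ν] [DecidableEq ν] [CommRing R]
  {q : Matrix ι ν R} {p : Matrix ν ι R}

/-- The transformation that clears the first block row and column of a pencil whose leading Fiedler
matrix is `topFiedler q p a`; it is invertible when `s * α + x * y = 1`. -/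
def pivot (q : Matrix ι ν R) (p : Matrix ν ι R) (x s α y : R) : Matrix (ν ⊕ ι) (ν ⊕ ι) R :=
  Matrix.fromBlocks (-x • 1) (s • p) (α • q) (extendByOne q p (y • 1))

theorem isUnit_det_pivot (hpq : p * q = 1) {x s α y : R} (h : s * α + x * y = 1) :
    IsUnit (pivot q p x s α y).det := by
  refine Matrix.isUnit_det_of_right_inverse (B := pivot q p y s α x) ?_
  rw [pivot, pivot, Matrix.fromBlocks_multiply, ← Matrix.fromBlocks_one]
  congr 1
  · simp only [Matrix.smul_mul, Matrix.mul_smul, hpq, Matrix.mul_one, smul_smul, ← add_smul]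
    rw [show -y * -x + α * s = 1 by linear_combination h, one_smul]
  · simp only [Matrix.smul_mul, Matrix.mul_smul, Matrix.one_mul, row_mul_extendByOne hpq]
    module
  · simp only [Matrix.mul_smul, Matrix.mul_one, extendByOne_mul_col hpq]
    module
  · rw [extendByOne_mul hpq, smul_mul_smul, mul_one, extendByOne_eq_add,
      show y * x = 1 - s * α by linear_combination h]
    simp only [extendByOne, zero_sub, Matrix.mul_neg, Matrix.neg_mul, Matrix.smul_mul,
      Matrix.mul_smul, Matrix.mul_one]
    module

theorem scaled_topFiedler_pencil_eq (s t x y : R) (K a : Matrix ν ν R) (M : Matrix ι ι R) :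
    s • Matrix.fromBlocks K 0 0 1 -
        t • (Matrix.fromBlocks (x • 1) 0 0 1 * (topFiedler q p a * Matrix.fromBlocks 1 0 0 M) *
          Matrix.fromBlocks (y • 1) 0 0 1) =
      Matrix.fromBlocks (s • K + (t * x * y) • a) (-(t * x) • (p * M)) (-(t * y) • q)
        (s • 1 - t • (extendByOne q p 0 * M)) := by
  simp only [topFiedler, Matrix.fromBlocks_multiply, Matrix.fromBlocks_smul, fromBlocks_sub]
  congr 1
  all_goals simp only [Matrix.smul_mul, Matrix.mul_smul, Matrix.one_mul, Matrix.mul_one,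
    Matrix.zero_mul, Matrix.mul_zero, add_zero, zero_add]
  all_goals module

theorem pivot_rotation_mul (hpq : p * q = 1) (s t x y : R) (k : Matrix ν ν R) (M : Matrix ι ι R) :
    pivot q p 0 1 1 0 * Matrix.fromBlocks k (-(t * x) • (p * M)) (-y • q)
        (s • 1 - t • (extendByOne q p 0 * M)) =
      Matrix.fromBlocks (-y • 1) (s • p) (q * k)
        (s • extendByOne q p 0 - t • (extendByOne q p (x • 1) * M)) := by
  rw [pivot, Matrix.fromBlocks_multiply]
  congr 1
  · simp [hpq]
  · simp [Matrix.mul_sub, ← Matrix.mul_assoc, row_mul_extendByOne hpq]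
  · simp [extendByOne_mul_col hpq]
  · rw [extendByOne_eq_add _ _ (x • 1)]
    simp only [Matrix.mul_smul, Matrix.smul_mul, Matrix.mul_sub, Matrix.add_mul, Matrix.mul_one,
      ← Matrix.mul_assoc, extendByOne_mul hpq, zero_smul, one_smul, mul_zero]
    module

theorem mul_pivot_eq (hpq : p * q = 1) {s y α β : R} (h : α * s + β * y = 1) (k : Matrix ν ν R)
    (N : Matrix ι ι R) :
    Matrix.fromBlocks (-y • 1) (s • p) (q * k) (s • extendByOne q p 0 - N) * pivot q p β s α y =
      Matrix.fromBlocks 1 0 (-(β • (q * k) + α • (N * q)))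
        (s • extendByOne q p k - N * extendByOne q p (y • 1)) := by
  rw [pivot, Matrix.fromBlocks_multiply]
  congr 1
  · simp only [Matrix.smul_mul, Matrix.mul_smul, hpq, Matrix.mul_one, smul_smul, ← add_smul]
    rw [show -β * -y + α * s = 1 by linear_combination h, one_smul]
  · simp [row_mul_extendByOne hpq]
  · simp only [Matrix.sub_mul, Matrix.mul_smul, Matrix.smul_mul, Matrix.mul_one,
      extendByOne_mul_col hpq, Matrix.mul_zero]
    module
  · rw [extendByOne_eq_add _ _ k]
    simp only [Matrix.sub_mul, Matrix.mul_smul, Matrix.smul_mul, extendByOne_mul hpq, zero_mul]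
    module

theorem uniformlyEquivalent_topFiedler_mul (hpq : p * q = 1) {s t x y : R}
    (hst : IsCoprime s (t * y)) (K a : Matrix ν ν R) :
    UniformlyEquivalent (IsUnit (t * y))
      (fun M : Matrix ι ι R ↦ s • Matrix.fromBlocks K 0 0 1 -
        t • (Matrix.fromBlocks (x • 1) 0 0 1 * (topFiedler q p a * Matrix.fromBlocks 1 0 0 M) *
          Matrix.fromBlocks (y • 1) 0 0 1))
      (fun M ↦ Matrix.fromBlocks 1 0 0 (s • extendByOne q p (s • K + (t * x * y) • a) -
        t • (extendByOne q p (x • 1) * M * extendByOne q p ((t * y) • 1)))) := by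
  obtain ⟨α, β, hαβ, hα⟩ : ∃ α β, α * s + β * (t * y) = 1 ∧ (IsUnit (t * y) → α = 0) := by
    by_cases h : IsUnit (t * y)
    · obtain ⟨β, hβ⟩ := h.exists_left_inv
      exact ⟨0, β, by simpa using hβ, fun _ ↦ rfl⟩
    · obtain ⟨α, β, hαβ⟩ := hst
      exact ⟨α, β, hαβ, fun h' ↦ absurd h' h⟩
  set k := s • K + (t * x * y) • a
  let W (M : Matrix ι ι R) : Matrix ι ν R :=
    β • (q * k) + α • (t • (extendByOne q p (x • 1) * M) * q)
  refine ⟨fun M ↦ Matrix.fromBlocks 1 0 (W M) 1 * pivot q p 0 1 1 0,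
    fun _ ↦ pivot q p β s α (t * y), fun M ↦ ⟨?_, ?_, ?_⟩, fun h M M' ↦ ?_⟩
  · simpa using isUnit_det_pivot hpq (by ring)
  · exact isUnit_det_pivot hpq (by linear_combination hαβ)
  · simp only [scaled_topFiedler_pencil_eq]
    rw [mul_assoc (Matrix.fromBlocks 1 0 _ 1), pivot_rotation_mul hpq, Matrix.mul_assoc,
      mul_pivot_eq hpq hαβ]
    simp [W, Matrix.fromBlocks_multiply, k]
  · simp [W, hα h]

end ReductionStep

section HomogeneousPolynomial

variable {R : Type*} [CommRing R] {n : ℕ}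

/-- The homogenization `∑ s^j t^(k+1-j) A_j` of a matrix polynomial of degree `k + 1` with leading
coefficient `K` and constant coefficient `A₀`; as in `fiedlerFactor`, `A j` is the coefficient of
`λ^(j+1)`. -/
def homPoly (k : ℕ) (s t : R) (K A₀ : Matrix (Fin n) (Fin n) R)
    (A : ℕ → Matrix (Fin n) (Fin n) R) : Matrix (Fin n) (Fin n) R :=
  s ^ (k + 1) • K + ∑ j ∈ Finset.range k, (s ^ (j + 1) * t ^ (k - j)) • A j + t ^ (k + 1) • A₀

theorem homPoly_succ (k : ℕ) (s t : R) (K A₀ : Matrix (Fin n) (Fin n) R)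
    (A : ℕ → Matrix (Fin n) (Fin n) R) :
    homPoly (k + 1) s t K A₀ A = homPoly k s t (s • K + t • A k) (t • A₀) (t • A) := by
  have hsum : ∑ j ∈ Finset.range k, (s ^ (j + 1) * t ^ (k + 1 - j)) • A j =
      ∑ j ∈ Finset.range k, (s ^ (j + 1) * t ^ (k - j)) • (t • A) j := by
    refine Finset.sum_congr rfl fun j hj ↦ ?_
    rw [Nat.succ_sub (Finset.mem_range.1 hj).le, Pi.smul_apply, smul_smul, pow_succ t, mul_assoc]
  rw [homPoly, homPoly, Finset.sum_range_succ, hsum, Nat.add_sub_cancel_left]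
  module

theorem homPoly_mul_mul (k : ℕ) (a s t : R) (K A₀ : Matrix (Fin n) (Fin n) R)
    (A : ℕ → Matrix (Fin n) (Fin n) R) :
    homPoly k (a * s) (a * t) K A₀ A = a ^ (k + 1) • homPoly k s t K A₀ A := by
  simp only [homPoly, smul_add, Finset.smul_sum, smul_smul, mul_pow]
  congr 2
  refine Finset.sum_congr rfl fun j hj ↦ ?_
  rw [show k + 1 = j + 1 + (k - j) by have := Finset.mem_range.1 hj; lia, pow_add a]
  congr 1
  ring

end HomogeneousPolynomial

section Reduction

variable {R : Type*} [CommRing R] {n : ℕ}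

variable (m : ℕ) in
/-- The Fiedler pencil `s M_{-m} - t M_σ` over an arbitrary ring, where `K` is the leading
coefficient and `l` lists the values of `σ`. -/
def fiedlerPencil (s t : R) (K A₀ : Matrix (Fin n) (Fin n) R) (A : ℕ → Matrix (Fin n) (Fin n) R)
    (l : List ℕ) : Matrix (Fin m × Fin n) (Fin m × Fin n) R :=
  s • leadBlock m K - t • fiedlerProd m A₀ A l

/-- A Fiedler pencil whose first block row and column have been scaled, in the part that comes from
the product, by `x` and `y`. These scalings arise when factors are stripped off. -/
def scaledPencil (k : ℕ) (s t x y : R) (K A₀ : Matrix (Fin n) (Fin n) R)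
    (A : ℕ → Matrix (Fin n) (Fin n) R) (l : List ℕ) :
    Matrix (Fin (k + 1) × Fin n) (Fin (k + 1) × Fin n) R :=
  s • leadBlock (k + 1) K -
    t • (leadBlock (k + 1) (x • 1) * fiedlerProd (k + 1) A₀ A l * leadBlock (k + 1) (y • 1))

theorem transpose_leadBlock (m : ℕ) (Y : Matrix (Fin n) (Fin n) R) :
    (leadBlock m Y)ᵀ = leadBlock m Yᵀ := by
  rw [leadBlock, extendByOne_transpose, unitCol_transpose, unitRow_transpose, leadBlock]

theorem elemZero_succ_eq_assemble (k : ℕ) (Y : Matrix (Fin n) (Fin n) R) :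
    elemZero (k + 2) Y = assemble (k + 1) (Matrix.fromBlocks 1 0 0 (elemZero (k + 1) Y)) := by
  rw [elemZero_eq_extendByOne, elemZero_eq_extendByOne, extendByOne_unitCol_eq_assemble k.succ_pos]

theorem UniformlyEquivalent.assemble_fromBlocks {ω : Type*} {c : Prop} {k : ℕ}
    {F G : ω → Matrix (Fin k × Fin n) (Fin k × Fin n) R} (h : UniformlyEquivalent c F G) :
    UniformlyEquivalent c (fun w ↦ assemble k (Matrix.fromBlocks 1 0 0 (F w)))
      (fun w ↦ assemble k (Matrix.fromBlocks 1 0 0 (G w))) :=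
  h.map (fun M ↦ assemble k (Matrix.fromBlocks 1 0 0 M))
    (fun M N ↦ by simp [← map_mul, Matrix.fromBlocks_multiply])
    fun M ↦ by rw [det_assemble, Matrix.det_fromBlocks_zero₂₁, Matrix.det_one, one_mul]

theorem uniformlyEquivalent_scaledPencil_left {k : ℕ} {s t x y : R} (hst : IsCoprime s (t * y))
    (K : Matrix (Fin n) (Fin n) R) (A : ℕ → Matrix (Fin n) (Fin n) R) {l l' : List ℕ}
    (hl : ∀ A₀ : Matrix (Fin n) (Fin n) R, fiedlerProd (k + 2) A₀ A l = assemble (k + 1)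
      (topFiedler (unitCol R n (k + 1) k) (unitRow R n (k + 1) k) (A k) *
        Matrix.fromBlocks 1 0 0 (fiedlerProd (k + 1) A₀ A l'))) :
    UniformlyEquivalent (IsUnit (t * y)) (fun A₀ ↦ scaledPencil (k + 1) s t x y K A₀ A l)
      (fun A₀ ↦ assemble (k + 1) (Matrix.fromBlocks 1 0 0
        (scaledPencil k s t x (t * y) (s • K + (t * x * y) • A k) A₀ A l'))) := by
  have hpq : unitRow R n (k + 1) k * unitCol R n (k + 1) k = 1 :=
    unitRow_mul_unitCol_self R n k.lt_succ_self
  have h := ((uniformlyEquivalent_topFiedler_mul (x := x) hpq hst K (A k)).map (assemble (k + 1))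
    (map_mul _) det_assemble).comp fun A₀ ↦ fiedlerProd (k + 1) A₀ A l'
  simp only [scaledPencil, leadBlock_eq_assemble (k := k + 1), hl]
  simpa only [leadBlock, Nat.add_sub_cancel, Function.comp_def, map_sub, map_smul, map_mul] using h

theorem scaledPencil_transpose (k : ℕ) (s t x y : R) (K A₀ : Matrix (Fin n) (Fin n) R)
    (A : ℕ → Matrix (Fin n) (Fin n) R) (l : List ℕ) :
    (scaledPencil k s t x y K A₀ A l)ᵀ =
      scaledPencil k s t y x Kᵀ A₀ᵀ (fun j ↦ (A j)ᵀ) l.reverse := by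
  simp [scaledPencil, transpose_leadBlock, fiedlerProd_transpose, Matrix.mul_assoc]

theorem assemble_transpose {k : ℕ}
    (M : Matrix (Fin n ⊕ Fin k × Fin n) (Fin n ⊕ Fin k × Fin n) R) :
    (assemble k M)ᵀ = assemble k Mᵀ := by
  simp [assemble]

theorem uniformlyEquivalent_scaledPencil_right {k : ℕ} {s t x y : R} (hst : IsCoprime s (t * x))
    (K : Matrix (Fin n) (Fin n) R) (A : ℕ → Matrix (Fin n) (Fin n) R) {l l' : List ℕ}
    (hl : ∀ A₀ : Matrix (Fin n) (Fin n) R, fiedlerProd (k + 2) A₀ A l = assemble (k + 1)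
      (Matrix.fromBlocks 1 0 0 (fiedlerProd (k + 1) A₀ A l') *
        topFiedler (unitCol R n (k + 1) k) (unitRow R n (k + 1) k) (A k))) :
    UniformlyEquivalent (IsUnit (t * x)) (fun A₀ ↦ scaledPencil (k + 1) s t x y K A₀ A l)
      (fun A₀ ↦ assemble (k + 1) (Matrix.fromBlocks 1 0 0
        (scaledPencil k s t (t * x) y (s • K + (t * y * x) • A k) A₀ A l'))) := by
  have hl' (A₀ : Matrix (Fin n) (Fin n) R) :
      fiedlerProd (k + 2) A₀ (fun j ↦ (A j)ᵀ) l.reverse = assemble (k + 1)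
        (topFiedler (unitCol R n (k + 1) k) (unitRow R n (k + 1) k) (A k)ᵀ *
          Matrix.fromBlocks 1 0 0 (fiedlerProd (k + 1) A₀ (fun j ↦ (A j)ᵀ) l'.reverse)) := by
    have h := congrArg Matrix.transpose (hl A₀ᵀ)
    simpa [fiedlerProd_transpose, assemble_transpose, Matrix.fromBlocks_transpose, topFiedler,
      extendByOne_transpose, unitCol_transpose, unitRow_transpose] using h
  simpa [Function.comp_def, scaledPencil_transpose, assemble_transpose,
    Matrix.fromBlocks_transpose] using
    ((uniformlyEquivalent_scaledPencil_left (x := y) hst Kᵀ _ hl').comp Matrix.transpose).transpose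

theorem scaledPencil_zero (s t x y : R) (K A₀ : Matrix (Fin n) (Fin n) R)
    (A : ℕ → Matrix (Fin n) (Fin n) R) :
    scaledPencil 0 s t x y K A₀ A [0] = elemZero 1 (s • K + (t * (x * y)) • A₀) := by
  have unit_mul_unit : unitCol R n 1 0 * unitRow R n 1 0 = 1 := by
    ext ⟨p, a⟩ ⟨q, b⟩
    simp [mul_unitRow_apply, unitCol, blockCol, Matrix.one_apply, Subsingleton.elim p q]
  have extend (Y : Matrix (Fin n) (Fin n) R) :
      extendByOne (unitCol R n 1 0) (unitRow R n 1 0) Y =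
        unitCol R n 1 0 * Y * unitRow R n 1 0 := by
    simp [extendByOne, Matrix.mul_sub, Matrix.sub_mul, unit_mul_unit]
  have hpq : unitRow R n 1 0 * unitCol R n 1 0 = 1 :=
    unitRow_mul_unitCol_self R n one_pos
  simp only [scaledPencil, leadBlock, fiedlerProd, List.map_cons, List.map_nil, List.prod_singleton,
    fiedlerFactor, elemZero_eq_extendByOne, zero_add, Nat.sub_self, extendByOne_mul hpq]
  simp [extend, Matrix.mul_add, Matrix.add_mul, mul_smul, smul_comm x y]

/-- The exponents `i` and `j` count the factors stripped off on the right and on the left. -/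
theorem uniformlyEquivalent_scaledPencil {k : ℕ} {s t : R} (hst : IsCoprime s t)
    {l : List ℕ} (hl : l.Perm (List.range (k + 1))) (i j : ℕ) (K : Matrix (Fin n) (Fin n) R)
    (A : ℕ → Matrix (Fin n) (Fin n) R) :
    UniformlyEquivalent (IsUnit t) (fun A₀ ↦ scaledPencil k s t (t ^ i) (t ^ j) K A₀ A l)
      (fun A₀ ↦ elemZero (k + 1) (homPoly k s t K (t ^ (i + j) • A₀) (t ^ (i + j) • A))) := by
  induction k generalizing l i j K with
  | zero =>
    obtain rfl := List.perm_singleton.1 hl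
    simpa [scaledPencil_zero, homPoly, smul_smul, pow_add] using
      UniformlyEquivalent.refl (IsUnit t) fun A₀ ↦ scaledPencil 0 s t (t ^ i) (t ^ j) K A₀ A [0]
  | succ k ih =>
    have hpoly (A₀ : Matrix (Fin n) (Fin n) R) (d : ℕ) :
        homPoly (k + 1) s t K (t ^ d • A₀) (t ^ d • A) =
          homPoly k s t (s • K + t ^ (d + 1) • A k) (t ^ (d + 1) • A₀) (t ^ (d + 1) • A) := by
      simp only [homPoly_succ, Pi.smul_apply, smul_smul, pow_succ']
    have hcoprime (d : ℕ) : IsCoprime s (t * t ^ d) := hst.mul_right hst.pow_right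
    have hunit (d : ℕ) (ht : IsUnit t) : IsUnit (t * t ^ d) := ht.mul (ht.pow d)
    simp only [hpoly, elemZero_succ_eq_assemble]
    obtain ⟨l', hl', h | h⟩ := exists_fiedlerProd_eq_assemble (R := R) (n := n) hl
    · refine ((uniformlyEquivalent_scaledPencil_left (hcoprime j) K A fun A₀ ↦ h A₀ A).mono
        (hunit j)).trans ?_
      rw [← pow_succ' t j, show t * t ^ i * t ^ j = t ^ (i + j + 1) by ring]
      exact (ih hl' i (j + 1) _).assemble_fromBlocks
    · refine ((uniformlyEquivalent_scaledPencil_right (hcoprime i) K A fun A₀ ↦ h A₀ A).mono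
        (hunit i)).trans ?_
      rw [← pow_succ' t i, show t * t ^ j * t ^ i = t ^ (i + j + 1) by ring,
        Nat.add_right_comm i j 1]
      exact (ih hl' (i + 1) j _).assemble_fromBlocks

theorem uniformlyEquivalent_fiedlerPencil {k : ℕ} {s t : R} (hst : IsCoprime s t)
    {l : List ℕ} (hl : l.Perm (List.range (k + 1))) (K : Matrix (Fin n) (Fin n) R)
    (A : ℕ → Matrix (Fin n) (Fin n) R) :
    UniformlyEquivalent (IsUnit t) (fun A₀ ↦ fiedlerPencil (k + 1) s t K A₀ A l)
      (fun A₀ ↦ elemZero (k + 1) (homPoly k s t K A₀ A)) := by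
  simpa [scaledPencil, leadBlock, extendByOne_one, fiedlerPencil] using
    uniformlyEquivalent_scaledPencil hst hl 0 0 K A

end Reduction

/-! ### The blocks `C` and `B` of the pencil -/

section Inversions

/-- The integer `i₀(α)` of an index tuple `α = l ++ 0 :: l'` in which `0` occurs only once. -/
def inversionCount (l : List ℕ) : ℕ :=
  l.foldr (fun a c ↦ if a = c + 1 then c + 1 else c) 0

theorem inversionCount_cons (a : ℕ) (l : List ℕ) :
    inversionCount (a :: l) =
      if a = inversionCount l + 1 then inversionCount l + 1 else inversionCount l :=
  rfl

theorem inversionCount_mem (l : List ℕ) : inversionCount l ∈ 0 :: l := by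
  induction l with
  | nil => exact List.mem_cons_self
  | cons a l ih => grind [inversionCount_cons]

theorem reverse_range'_sublist_iff {l₁ l₂ : List ℕ} (h₂ : 0 ∉ l₂) (q : ℕ) :
    (List.range' 0 (q + 1)).reverse.Sublist (l₁ ++ 0 :: l₂) ↔ q ≤ inversionCount l₁ := by
  have hq (q : ℕ) : (List.range' 0 (q + 1)).reverse = q :: (List.range' 0 q).reverse := by
    simp [List.range'_concat]
  induction l₁ generalizing q with
  | nil =>
    cases q with
    | zero => simp [inversionCount]
    | succ q =>
      have : 0 ∉ l₂ → ¬ ((q + 1) :: (List.range' 0 (q + 1)).reverse).Sublist l₂ := fun h₂ h ↦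
        h₂ (h.subset (by simp))
      rw [hq]
      simp [inversionCount, List.cons_sublist_cons', this h₂]
  | cons a l₁ ih =>
    rw [hq, List.cons_append, List.cons_sublist_cons', ← hq q]
    cases q with
    | zero => simp
    | succ q =>
      simp only [ih, inversionCount_cons]
      split_ifs <;> lia

theorem hasInversions_inversionCount {l₁ l₂ : List ℕ} (h₂ : 0 ∉ l₂) :
    HasInversions (l₁ ++ 0 :: l₂) 0 (inversionCount l₁) := by
  simp only [HasInversions, reverse_range'_sublist_iff h₂, le_refl, true_and]
  lia

theorem hasConsecutions_inversionCount {l₁ l₂ : List ℕ} (h₁ : 0 ∉ l₁) :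
    HasConsecutions (l₁ ++ 0 :: l₂) 0 (inversionCount l₂.reverse) := by
  have h := hasInversions_inversionCount (l₁ := l₂.reverse) (l₂ := l₁.reverse) (by simpa)
  rw [show l₂.reverse ++ 0 :: l₁.reverse = (l₁ ++ 0 :: l₂).reverse by simp] at h
  simpa only [HasInversions, HasConsecutions, List.reverse_sublist] using h

theorem tuple_perm {m : ℕ} (σ : Equiv.Perm (Fin m)) : (tuple σ).Perm (List.range m) := by
  rw [tuple, ← List.map_coe_finRange_eq_range, List.ofFn_eq_map]
  simpa [List.map_map, Function.comp_def] using (σ.map_finRange_perm).map ((↑) : Fin m → ℕ)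

end Inversions

section CoefficientPosition

variable {R : Type*} [CommRing R] {m n : ℕ} (A₀ : Matrix (Fin n) (Fin n) R)
  (A : ℕ → Matrix (Fin n) (Fin n) R)

theorem elemZero_add (Y Z : Matrix (Fin n) (Fin n) R) :
    elemZero m (Y + Z) = elemZero m Y + unitCol R n m 0 * Z * unitRow R n m 0 := by
  rw [elemZero_eq_extendByOne, elemZero_eq_extendByOne, extendByOne_eq_add,
    extendByOne_eq_add _ _ Y, Matrix.mul_add, Matrix.add_mul, add_assoc]

theorem fiedlerProd_mul_unitCol {l : List ℕ} (hnodup : (0 :: l).Nodup) (hl : ∀ i ∈ 0 :: l, i < m) :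
    fiedlerProd m A₀ A l * unitCol R n m 0 = unitCol R n m (inversionCount l) := by
  induction l with
  | nil => simp [fiedlerProd, inversionCount]
  | cons a l ih =>
    have hmem := inversionCount_mem l
    have hlt : inversionCount l < m := hl _ (by grind)
    have hne : a ≠ inversionCount l := by grind
    rw [fiedlerProd_cons, Matrix.mul_assoc, ih (by grind) (by grind), inversionCount_cons]
    split_ifs with ha
    · rw [ha, fiedlerFactor, elemSucc_mul_unitCol hlt]
    · exact fiedlerFactor_mul_unitCol_of_ne _ _ hlt hne ha

theorem unitRow_mul_fiedlerProd {l : List ℕ} (hnodup : (0 :: l).Nodup) (hl : ∀ i ∈ 0 :: l, i < m) :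
    unitRow R n m 0 * fiedlerProd m A₀ A l = unitRow R n m (inversionCount l.reverse) := by
  apply Matrix.transpose_injective
  rw [Matrix.transpose_mul, fiedlerProd_transpose, unitRow_transpose, unitRow_transpose,
    fiedlerProd_mul_unitCol _ _ (by simpa using hnodup) (by simpa using hl)]

theorem fiedlerProd_add_constCoeff {l₁ l₂ : List ℕ} (hl : (l₁ ++ 0 :: l₂).Perm (List.range m))
    (Z : Matrix (Fin n) (Fin n) R) :
    fiedlerProd m (A₀ + Z) A (l₁ ++ 0 :: l₂) = fiedlerProd m A₀ A (l₁ ++ 0 :: l₂) -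
      unitCol R n m (inversionCount l₁) * Z * unitRow R n m (inversionCount l₂.reverse) := by
  have hlt (i : ℕ) (hi : i ∈ l₁ ∨ i = 0 ∨ i ∈ l₂) : i < m :=
    List.mem_range.1 (hl.mem_iff.1 (by simpa using hi))
  have hnodup : (l₁ ++ 0 :: l₂).Nodup := hl.nodup_iff.2 List.nodup_range
  have hfactor : fiedlerFactor m (A₀ + Z) A 0 =
      fiedlerFactor m A₀ A 0 - unitCol R n m 0 * Z * unitRow R n m 0 := by
    rw [fiedlerFactor, fiedlerFactor, neg_add, elemZero_add, Matrix.mul_neg, Matrix.neg_mul,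
      sub_eq_add_neg]
  rw [← fiedlerProd_mul_unitCol A₀ A (l := l₁) (by grind) (by grind),
    ← unitRow_mul_fiedlerProd A₀ A (l := l₂) (by grind) (by grind)]
  simp only [fiedlerProd_append, fiedlerProd_cons, hfactor,
    fiedlerProd_congr_of_notMem A A₀ (A₀ := A₀ + Z) (l := l₁) (by grind),
    fiedlerProd_congr_of_notMem A A₀ (A₀ := A₀ + Z) (l := l₂) (by grind),
    Matrix.mul_sub, Matrix.sub_mul, Matrix.mul_assoc]

theorem fiedlerPencil_add_constCoeff (s t : R) (K Z : Matrix (Fin n) (Fin n) R) {l₁ l₂ : List ℕ}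
    (hl : (l₁ ++ 0 :: l₂).Perm (List.range m)) :
    fiedlerPencil m s t K (A₀ + Z) A (l₁ ++ 0 :: l₂) =
      fiedlerPencil m s t K A₀ A (l₁ ++ 0 :: l₂) + t • (unitCol R n m (inversionCount l₁) * Z *
        unitRow R n m (inversionCount l₂.reverse)) := by
  rw [fiedlerPencil, fiedlerPencil, fiedlerProd_add_constCoeff A₀ A hl]
  module

theorem homPoly_add_constCoeff (k : ℕ) (s t : R) (K Z : Matrix (Fin n) (Fin n) R) :
    homPoly k s t K (A₀ + Z) A = homPoly k s t K A₀ A + t ^ (k + 1) • Z := by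
  rw [homPoly, homPoly, smul_add, add_assoc _ (_ • A₀)]

end CoefficientPosition

section Normalization

variable {R : Type*} [CommRing R] {n : ℕ}

/-- If `u Z v = e Z f` for all `Z`, then `u` and `v` differ from `e` and `f` by mutually inverse
matrices that commute with all `Z`. -/
theorem exists_isUnit_det_mul_eq_of_mul_mul_eq {ι ν : Type*} [Fintype ι] [DecidableEq ι]
    [Fintype ν] [DecidableEq ν] {e u : Matrix ι ν R} {f v : Matrix ν ι R} (hfe : f * e = 1)
    (h : ∀ Z : Matrix ν ν R, u * Z * v = e * Z * f) :
    ∃ M N : Matrix ι ι R, IsUnit M.det ∧ IsUnit N.det ∧ M * u = e ∧ v * N = f ∧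
      ∀ Y : Matrix ν ν R, M * extendByOne e f Y * N = extendByOne e f Y := by
  have hconj (Z : Matrix ν ν R) : f * u * Z * (v * e) = Z := by
    rw [show f * u * Z * (v * e) = f * (u * Z * v) * e by simp only [Matrix.mul_assoc], h]
    simp only [← Matrix.mul_assoc, hfe, Matrix.one_mul]
    rw [Matrix.mul_assoc, hfe, Matrix.mul_one]
  have hinv : f * u * (v * e) = 1 := by simpa using hconj 1
  have hinv' : v * e * (f * u) = 1 := mul_eq_one_comm.1 hinv
  have hu : u * (v * e) = e := by simpa [Matrix.mul_assoc, hfe] using congrArg (· * e) (h 1)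
  have hv : f * u * v = f := by simpa [← Matrix.mul_assoc, hfe] using congrArg (f * ·) (h 1)
  have hMN : extendByOne e f (v * e) * extendByOne e f (f * u) = 1 := by
    rw [extendByOne_mul hfe, hinv', extendByOne_one]
  have hu' : e * (f * u) = u := by rw [← hu, Matrix.mul_assoc, hinv', Matrix.mul_one]
  have hv' : v * e * f = v := by rw [← hv, ← Matrix.mul_assoc, hinv', Matrix.one_mul]
  refine ⟨extendByOne e f (v * e), extendByOne e f (f * u),
    Matrix.isUnit_det_of_right_inverse hMN, Matrix.isUnit_det_of_left_inverse hMN, ?_, ?_,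
    fun Y ↦ ?_⟩
  · rw [← hu', ← Matrix.mul_assoc, extendByOne_mul_col hfe, Matrix.mul_assoc, hinv',
      Matrix.mul_one]
  · rw [← hv', Matrix.mul_assoc, row_mul_extendByOne hfe, ← Matrix.mul_assoc, hinv',
      Matrix.one_mul]
  · rw [extendByOne_mul hfe, extendByOne_mul hfe]
    congr 1
    calc v * e * Y * (f * u) = v * e * (f * u * Y * (v * e)) * (f * u) := by rw [hconj]
      _ = v * e * (f * u) * Y * (v * e * (f * u)) := by simp only [Matrix.mul_assoc]
      _ = Y := by rw [hinv', Matrix.one_mul, Matrix.mul_one]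

theorem exists_fiedlerPencil_normalization {k : ℕ} {l₁ l₂ : List ℕ}
    (hl : (l₁ ++ 0 :: l₂).Perm (List.range (k + 1))) (s : R) (K A₀ : Matrix (Fin n) (Fin n) R)
    (A : ℕ → Matrix (Fin n) (Fin n) R) :
    ∃ U V : Matrix (Fin (k + 1) × Fin n) (Fin (k + 1) × Fin n) R,
      IsUnit U.det ∧ IsUnit V.det ∧
      U * fiedlerPencil (k + 1) s 1 K A₀ A (l₁ ++ 0 :: l₂) * V =
        elemZero (k + 1) (homPoly k s 1 K A₀ A) ∧
      U * unitCol R n (k + 1) (inversionCount l₁) = unitCol R n (k + 1) 0 ∧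
      unitRow R n (k + 1) (inversionCount l₂.reverse) * V = unitRow R n (k + 1) 0 := by
  obtain ⟨U, V, hUV, hconst⟩ :=
    uniformlyEquivalent_fiedlerPencil (isCoprime_one_right (x := s)) hl K A
  beta_reduce at hUV
  obtain ⟨hU, hV, h⟩ := hUV A₀
  have hZ (Z : Matrix (Fin n) (Fin n) R) :
      U A₀ * unitCol R n (k + 1) (inversionCount l₁) * Z *
          (unitRow R n (k + 1) (inversionCount l₂.reverse) * V A₀) =
        unitCol R n (k + 1) 0 * Z * unitRow R n (k + 1) 0 := by
    have hsum := (hUV (A₀ + Z)).2.2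
    rw [(hconst isUnit_one (A₀ + Z) A₀).1, (hconst isUnit_one (A₀ + Z) A₀).2,
      fiedlerPencil_add_constCoeff A₀ A s 1 K Z hl, homPoly_add_constCoeff, elemZero_add, mul_add,
      add_mul, h, one_pow, one_smul, one_smul, add_right_inj] at hsum
    simpa only [Matrix.mul_assoc] using hsum
  have hunit : unitRow R n (k + 1) 0 * unitCol R n (k + 1) 0 = 1 :=
    unitRow_mul_unitCol_self R n k.succ_pos
  obtain ⟨M, N, hM, hN, hMu, hvN, hMN⟩ := exists_isUnit_det_mul_eq_of_mul_mul_eq hunit hZ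
  refine ⟨M * U A₀, V A₀ * N, by simpa using hM.mul hU, by simpa using hV.mul hN, ?_, ?_, ?_⟩
  · rw [mul_assoc M, mul_assoc M, ← mul_assoc (_ * _) (V A₀), h, ← mul_assoc,
      elemZero_eq_extendByOne, hMN]
  · rw [Matrix.mul_assoc, hMu]
  · rw [← Matrix.mul_assoc, hvN]

end Normalization

/-! ### Minimality -/

section ConstAndToRat

variable {ι κ τ : Type*}

theorem const_mul [Fintype κ] (M : Matrix ι κ ℂ) (N : Matrix κ τ ℂ) :
    const (M * N) = const M * const N :=
  Matrix.map_mul (f := (Polynomial.C : ℂ →+* ℂ[X]))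

theorem const_add (M N : Matrix ι κ ℂ) : const (M + N) = const M + const N :=
  Matrix.map_add _ (fun _ _ ↦ Polynomial.C_add) M N

theorem const_single [DecidableEq ι] [DecidableEq κ] (i : ι) (j : κ) (c : ℂ) :
    const (Matrix.single i j c) = Matrix.single i j (Polynomial.C c) :=
  Matrix.map_single i j c Polynomial.C

theorem det_const [Fintype ι] [DecidableEq ι] (M : Matrix ι ι ℂ) :
    (const M).det = Polynomial.C M.det :=
  ((Polynomial.C : ℂ →+* ℂ[X]).map_det M).symm

theorem toRat_mul [Fintype κ] (M : Matrix ι κ ℂ[X]) (N : Matrix κ τ ℂ[X]) :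
    toRat (M * N) = toRat M * toRat N :=
  Matrix.map_mul (f := algebraMap ℂ[X] (RatFunc ℂ))

theorem toRat_add (M N : Matrix ι κ ℂ[X]) : toRat (M + N) = toRat M + toRat N :=
  Matrix.map_add _ (map_add _) M N

theorem det_toRat [Fintype ι] [DecidableEq ι] (M : Matrix ι ι ℂ[X]) :
    (toRat M).det = algebraMap ℂ[X] (RatFunc ℂ) M.det :=
  ((algebraMap ℂ[X] (RatFunc ℂ)).map_det M).symm

end ConstAndToRat

section Minimality

variable {ι κ : Type*} {r : ℕ} {E A : Matrix (Fin r) (Fin r) ℂ}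

theorem det_pencil_ne_zero (hE : E.det ≠ 0) : ((X : ℂ[X]) • const E - const A).det ≠ 0 := by
  have hfactor : (X : ℂ[X]) • const E - const A = const E * Matrix.charmatrix (E⁻¹ * A) := by
    change _ = _ * (Matrix.scalar (Fin r) (X : ℂ[X]) - const (E⁻¹ * A))
    rw [mul_sub, ← const_mul, Matrix.mul_nonsing_inv_cancel_left _ _ hE.isUnit,
      Matrix.scalar_apply, ← Matrix.smul_one_eq_diagonal, mul_smul_comm, mul_one]
  rw [hfactor, Matrix.det_mul, det_const]
  exact mul_ne_zero (Polynomial.C_ne_zero.2 hE) (Matrix.charpoly_monic _).ne_zero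

theorem isUnit_det_toRat_pencil (hE : E.det ≠ 0) :
    IsUnit (toRat ((X : ℂ[X]) • const E - const A)).det := by
  rw [det_toRat, isUnit_iff_ne_zero]
  simpa using det_pencil_ne_zero hE

theorem matrixPolynomial_induction [Finite ι] [Finite κ] {p : Matrix ι κ ℂ[X] → Prop}
    (hconst : ∀ M, p (const M)) (hadd : ∀ M N, p M → p N → p (M + N))
    (hX : ∀ M, p M → p ((X : ℂ[X]) • M)) (M : Matrix ι κ ℂ[X]) : p M := by
  classical
  induction M using Matrix.induction_on' with
  | h_zero => simpa [const] using hconst 0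
  | h_add M N hM hN => exact hadd M N hM hN
  | h_std_basis i j q =>
    induction q using Polynomial.induction_on with
    | C c => exact const_single i j c ▸ hconst _
    | add q q' hq hq' => exact Matrix.single_add i j q q' ▸ hadd _ _ hq hq'
    | monomial k c ih =>
      have h := hX _ ih
      rwa [Matrix.smul_single, smul_eq_mul, mul_left_comm, ← pow_succ'] at h

theorem exists_eq_mul_pencil_add_const [Finite ι] (hE : E.det ≠ 0) (W : Matrix ι (Fin r) ℂ[X]) :
    ∃ (Q : Matrix ι (Fin r) ℂ[X]) (W₀ : Matrix ι (Fin r) ℂ),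
      W = Q * ((X : ℂ[X]) • const E - const A) + const W₀ := by
  induction W using matrixPolynomial_induction with
  | hconst W₀ => exact ⟨0, W₀, by simp⟩
  | hadd W W' hW hW' =>
    obtain ⟨Q, W₀, rfl⟩ := hW
    obtain ⟨Q', W₀', rfl⟩ := hW'
    exact ⟨Q + Q', W₀ + W₀', by rw [Matrix.add_mul, const_add]; abel⟩
  | hX W hW =>
    obtain ⟨Q, W₀, rfl⟩ := hW
    -- `λ W₀ = W₀ E⁻¹ (λ E - A) + W₀ E⁻¹ A`
    refine ⟨(X : ℂ[X]) • Q + const (W₀ * E⁻¹), W₀ * E⁻¹ * A, ?_⟩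
    have hW₀ : const (W₀ * E⁻¹) * const E = const W₀ := by
      rw [← const_mul, Matrix.nonsing_inv_mul_cancel_right _ _ hE.isUnit]
    rw [Matrix.add_mul, Matrix.mul_sub (const _), Matrix.mul_smul, hW₀, const_mul _ A, smul_add,
      Matrix.smul_mul]
    abel

theorem exists_eq_pencil_mul_add_const [Finite ι] (hE : E.det ≠ 0) (W : Matrix (Fin r) ι ℂ[X]) :
    ∃ (Q : Matrix (Fin r) ι ℂ[X]) (W₀ : Matrix (Fin r) ι ℂ),
      W = ((X : ℂ[X]) • const E - const A) * Q + const W₀ := by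
  obtain ⟨Q, W₀, h⟩ := exists_eq_mul_pencil_add_const (E := Eᵀ) (A := Aᵀ)
    (by rwa [Matrix.det_transpose]) Wᵀ
  refine ⟨Qᵀ, W₀ᵀ, ?_⟩
  rw [← Matrix.transpose_transpose W, h, Matrix.transpose_add, Matrix.transpose_mul]
  rfl

theorem exists_realization_mul [Fintype ι] [Finite κ] (T : Realization ι r)
    (W : Matrix κ ι ℂ[X]) (W' : Matrix ι κ ℂ[X]) :
    ∃ T' : Realization κ r, T'.transfer = toRat W * T.transfer * toRat W' := by
  obtain ⟨Q, C₀, hC⟩ := exists_eq_mul_pencil_add_const (A := T.A) T.det_E (W * const T.C)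
  obtain ⟨Q', B₀, hB⟩ := exists_eq_pencil_mul_add_const (A := T.A) T.det_E (const T.B * W')
  refine ⟨⟨W * T.P * W' + Q * const T.B * W' + const C₀ * Q', C₀, T.E, T.A, B₀, T.det_E⟩, ?_⟩
  set D := (X : ℂ[X]) • const T.E - const T.A with hD
  have hu : IsUnit (toRat D).det := isUnit_det_toRat_pencil T.det_E
  apply_fun toRat at hC hB
  rw [toRat_mul, toRat_add, toRat_mul] at hC hB
  have hstrict : toRat W * (toRat (const T.C) * (toRat D)⁻¹ * toRat (const T.B)) * toRat W' =
      toRat Q * (toRat (const T.B) * toRat W') + toRat (const C₀) * toRat Q' +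
        toRat (const C₀) * (toRat D)⁻¹ * toRat (const B₀) :=
    calc
      _ = toRat W * toRat (const T.C) * (toRat D)⁻¹ * (toRat (const T.B) * toRat W') := by
        simp only [Matrix.mul_assoc]
      _ = toRat Q * (toRat (const T.B) * toRat W') +
          toRat (const C₀) * ((toRat D)⁻¹ * (toRat (const T.B) * toRat W')) := by
        rw [hC, Matrix.add_mul, Matrix.mul_nonsing_inv_cancel_right _ _ hu, Matrix.add_mul,
          Matrix.mul_assoc (toRat (const C₀))]
      _ = _ := by
        nth_rw 2 [hB]
        rw [Matrix.mul_add (toRat D)⁻¹, Matrix.nonsing_inv_mul_cancel_left _ _ hu, Matrix.mul_add,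
          ← Matrix.mul_assoc (toRat (const C₀)) (toRat D)⁻¹, add_assoc]
  simp only [Realization.transfer, ← hD]
  rw [Matrix.mul_add, Matrix.add_mul, hstrict]
  simp only [toRat_add, toRat_mul, Matrix.mul_assoc, add_assoc]

theorem Realization.IsMinimal.of_transfer_eq_mul [Fintype ι] [Finite κ] {S : Realization κ r}
    (hS : S.IsMinimal) {T : Realization ι r} (W : Matrix κ ι ℂ[X]) (W' : Matrix ι κ ℂ[X])
    (h : S.transfer = toRat W * T.transfer * toRat W') : T.IsMinimal := by
  intro s T₁ hT₁
  obtain ⟨T₂, hT₂⟩ := exists_realization_mul T₁ W W'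
  exact hS s T₂ (by rw [hT₂, hT₁, h])

end Minimality

/-! ### Equivalence over the proper rational functions -/

section Map

variable {R S : Type*} [CommRing R] [CommRing S] {n : ℕ} (φ : R →+* S)
  (A₀ : Matrix (Fin n) (Fin n) R) (A : ℕ → Matrix (Fin n) (Fin n) R)

theorem elemZero_map (m : ℕ) (Y : Matrix (Fin n) (Fin n) R) :
    (elemZero m Y).map φ = elemZero m (Y.map φ) := by
  simp only [elemZero_eq_extendByOne, extendByOne_map, unitCol_map, unitRow_map]

theorem leadBlock_map (m : ℕ) (Y : Matrix (Fin n) (Fin n) R) :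
    (leadBlock m Y).map φ = leadBlock m (Y.map φ) := by
  simp only [leadBlock, extendByOne_map, unitCol_map, unitRow_map]

theorem fiedlerPencil_map (m : ℕ) (s t : R) (K : Matrix (Fin n) (Fin n) R) (l : List ℕ) :
    (fiedlerPencil m s t K A₀ A l).map φ =
      fiedlerPencil m (φ s) (φ t) (K.map φ) (A₀.map φ) (fun j ↦ (A j).map φ) l := by
  simp only [fiedlerPencil, Matrix.map_sub, Matrix.map_smul', map_sub, map_mul, leadBlock_map,
    fiedlerProd_map, implies_true]

theorem homPoly_map (k : ℕ) (s t : R) (K : Matrix (Fin n) (Fin n) R) :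
    (homPoly k s t K A₀ A).map φ =
      homPoly k (φ s) (φ t) (K.map φ) (A₀.map φ) (fun j ↦ (A j).map φ) := by
  simp only [homPoly, ← RingHom.mapMatrix_apply, map_add, map_sum]
  simp only [RingHom.mapMatrix_apply, Matrix.map_smul', map_mul, map_pow, implies_true]

end Map

section ProperRationalFunctions

theorem eventually_eval_denom_ne_zero (f : RatFunc ℂ) :
    ∀ᶠ z in Bornology.cobounded ℂ, Polynomial.eval₂ (RingHom.id ℂ) z f.denom ≠ 0 := by
  have hfin : {z : ℂ | f.denom.IsRoot z}.Finite :=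
    Polynomial.finite_setOfPred_isRoot f.denom_ne_zero
  exact Bornology.isBounded_def.1 hfin.isBounded

theorem eventually_eval_inv (f : RatFunc ℂ) :
    ∀ᶠ z in Bornology.cobounded ℂ,
      RatFunc.eval (RingHom.id ℂ) z f⁻¹ = (RatFunc.eval (RingHom.id ℂ) z f)⁻¹ := by
  obtain rfl | hf := eq_or_ne f 0
  · simp
  filter_upwards [eventually_eval_denom_ne_zero f, eventually_eval_denom_ne_zero f⁻¹] with z h h'
  refine eq_inv_of_mul_eq_one_right ?_
  rw [← RatFunc.eval_mul _ _ h h', mul_inv_cancel₀ hf, RatFunc.eval_one]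

/-- The rational function `f` tends to `d` at infinity. -/
def HasLimit (f : RatFunc ℂ) (d : ℂ) : Prop :=
  Filter.Tendsto (fun z : ℂ ↦ RatFunc.eval (RingHom.id ℂ) z f) (Bornology.cobounded ℂ) (nhds d)

theorem hasLimit_C (c : ℂ) : HasLimit (RatFunc.C c) c := by
  simp [HasLimit, RatFunc.eval_C]

theorem hasLimit_inv_X : HasLimit (RatFunc.X : RatFunc ℂ)⁻¹ 0 := by
  refine Filter.tendsto_inv₀_cobounded.congr' ?_
  filter_upwards [eventually_eval_inv RatFunc.X] with z hz
  rw [hz, RatFunc.eval_X]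

namespace HasLimit

variable {f g : RatFunc ℂ} {a b : ℂ}

theorem unique (ha : HasLimit f a) (hb : HasLimit f b) : a = b :=
  tendsto_nhds_unique ha hb

theorem add (hf : HasLimit f a) (hg : HasLimit g b) : HasLimit (f + g) (a + b) := by
  refine (Filter.Tendsto.add hf hg).congr' ?_
  filter_upwards [eventually_eval_denom_ne_zero f, eventually_eval_denom_ne_zero g] with z hf hg
  exact (RatFunc.eval_add _ _ hf hg).symm

theorem mul (hf : HasLimit f a) (hg : HasLimit g b) : HasLimit (f * g) (a * b) := by
  refine (Filter.Tendsto.mul hf hg).congr' ?_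
  filter_upwards [eventually_eval_denom_ne_zero f, eventually_eval_denom_ne_zero g] with z hf hg
  exact (RatFunc.eval_mul _ _ hf hg).symm

theorem inv (hf : HasLimit f a) (ha : a ≠ 0) : HasLimit f⁻¹ a⁻¹ :=
  (Filter.Tendsto.inv₀ hf ha).congr' ((eventually_eval_inv f).mono fun _ hz ↦ hz.symm)

end HasLimit

/-- The ring of proper rational functions, those which have a limit at infinity. -/
def properRing : Subring (RatFunc ℂ) where
  carrier := {f | ∃ d, HasLimit f d}
  mul_mem' := fun ⟨_, ha⟩ ⟨_, hb⟩ ↦ ⟨_, ha.mul hb⟩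
  one_mem' := ⟨1, by simpa using hasLimit_C 1⟩
  add_mem' := fun ⟨_, ha⟩ ⟨_, hb⟩ ↦ ⟨_, ha.add hb⟩
  zero_mem' := ⟨0, by simpa using hasLimit_C 0⟩
  neg_mem' := fun ⟨_, ha⟩ ↦ ⟨_, by simpa using (hasLimit_C (-1)).mul ha⟩

/-- The value at infinity of a proper rational function. -/
def limitHom : properRing →+* ℂ where
  toFun f := f.2.choose
  map_one' := (1 : properRing).2.choose_spec.unique (by simpa using hasLimit_C 1)
  map_zero' := (0 : properRing).2.choose_spec.unique (by simpa using hasLimit_C 0)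
  map_add' f g := (f + g).2.choose_spec.unique (f.2.choose_spec.add g.2.choose_spec)
  map_mul' f g := (f * g).2.choose_spec.unique (f.2.choose_spec.mul g.2.choose_spec)

theorem hasLimit_limitHom (f : properRing) : HasLimit f (limitHom f) := f.2.choose_spec

theorem HasLimit.limitHom_eq {f : properRing} {d : ℂ} (h : HasLimit f d) : limitHom f = d :=
  (hasLimit_limitHom f).unique h

theorem isUnit_of_limitHom_ne_zero {f : properRing} (h : limitHom f ≠ 0) : IsUnit f := by
  have hf : (f : RatFunc ℂ) ≠ 0 := by
    intro hf
    obtain rfl : f = 0 := Subtype.ext hf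
    exact h (map_zero limitHom)
  exact IsUnit.of_mul_eq_one (⟨(f : RatFunc ℂ)⁻¹, _, (hasLimit_limitHom f).inv h⟩ : properRing)
    (Subtype.ext (mul_inv_cancel₀ hf))

theorem isBiproper_map {ι : Type*} [Fintype ι] [DecidableEq ι] {U : Matrix ι ι properRing}
    (hU : IsUnit U.det) : IsBiproper (U.map properRing.subtype) := by
  refine ⟨U.map limitHom,
    tendsto_pi_nhds.2 fun i ↦ tendsto_pi_nhds.2 fun j ↦ hasLimit_limitHom (U i j), ?_⟩
  rw [← RingHom.mapMatrix_apply, ← RingHom.map_det]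
  exact (hU.map limitHom).ne_zero

/-- Complex numbers as proper rational functions. -/
def properConst : ℂ →+* properRing :=
  RatFunc.C.codRestrict properRing fun c ↦ ⟨c, hasLimit_C c⟩

/-- The proper rational function `λ⁻¹`. -/
def properInvX : properRing := ⟨(RatFunc.X : RatFunc ℂ)⁻¹, 0, hasLimit_inv_X⟩

theorem toRat_const {ι κ : Type*} (M : Matrix ι κ ℂ) :
    toRat (const M) = (M.map properConst).map properRing.subtype :=
  rfl

theorem toRat_pencil {ι κ : Type*} (E A : Matrix ι κ ℂ) :
    toRat ((X : ℂ[X]) • const E - const A) = (RatFunc.X : RatFunc ℂ) •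
      (E.map properConst - properInvX • A.map properConst).map properRing.subtype := by
  ext i j
  have hX : (RatFunc.X : RatFunc ℂ) ≠ 0 := RatFunc.X_ne_zero
  change algebraMap ℂ[X] (RatFunc ℂ) (X * Polynomial.C (E i j) - Polynomial.C (A i j)) =
    RatFunc.X * (RatFunc.C (E i j) - RatFunc.X⁻¹ * RatFunc.C (A i j))
  rw [map_sub, map_mul, RatFunc.algebraMap_X, RatFunc.algebraMap_C, RatFunc.algebraMap_C, mul_sub,
    mul_inv_cancel_left₀ hX]

theorem exists_toRat_pencil_inv_eq_map {ι : Type*} [Fintype ι] [DecidableEq ι]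
    {E A : Matrix ι ι ℂ} (hE : E.det ≠ 0) :
    ∃ N : Matrix ι ι properRing,
      (toRat ((X : ℂ[X]) • const E - const A))⁻¹ = N.map properRing.subtype := by
  set M : Matrix ι ι properRing := E.map properConst - properInvX • A.map properConst with hM
  have hlim : limitHom.mapMatrix M = E := by
    ext i j
    simp [hM, fun c ↦ HasLimit.limitHom_eq (f := properConst c) (hasLimit_C c),
      HasLimit.limitHom_eq (f := properInvX) hasLimit_inv_X]
  have hdet : IsUnit M.det :=
    isUnit_of_limitHom_ne_zero (by rwa [RingHom.map_det, hlim])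
  have hsmul : (properInvX • M⁻¹).map properRing.subtype =
      (RatFunc.X : RatFunc ℂ)⁻¹ • M⁻¹.map properRing.subtype := rfl
  refine ⟨properInvX • M⁻¹, Matrix.inv_eq_right_inv ?_⟩
  rw [toRat_pencil, hsmul, Matrix.smul_mul, Matrix.mul_smul, ← Matrix.map_mul,
    Matrix.mul_nonsing_inv _ hdet, smul_smul, mul_inv_cancel₀ RatFunc.X_ne_zero, one_smul]
  exact Matrix.map_one _ (map_zero _) (map_one _)

theorem biproperEquivalent_fiedlerPencil {n k : ℕ} {l : List ℕ}
    (hl : l.Perm (List.range (k + 1))) (K A₀ : Matrix (Fin n) (Fin n) properRing)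
    (A : ℕ → Matrix (Fin n) (Fin n) properRing) :
    BiproperEquivalent
      (homPoly k RatFunc.X 1 (K.map properRing.subtype) (A₀.map properRing.subtype)
        fun j ↦ (A j).map properRing.subtype)
      (fiedlerPencil (k + 1) RatFunc.X 1 (K.map properRing.subtype) (A₀.map properRing.subtype)
        (fun j ↦ (A j).map properRing.subtype) l) := by
  obtain ⟨U, V, hUV, -⟩ :=
    uniformlyEquivalent_fiedlerPencil (isCoprime_one_left (x := properInvX)) hl K A
  beta_reduce at hUV
  obtain ⟨hU, hV, h⟩ := hUV A₀
  refine ⟨_, _, isBiproper_map hU, isBiproper_map hV, ?_⟩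
  have hX : (RatFunc.X : RatFunc ℂ)⁻¹ * RatFunc.X = 1 := inv_mul_cancel₀ RatFunc.X_ne_zero
  apply_fun (fun M ↦ M.map properRing.subtype) at h
  rw [Matrix.map_mul, Matrix.map_mul, fiedlerPencil_map, elemZero_map, homPoly_map, map_one] at h
  rw [← inv_pow, ← homPoly_mul_mul, fiedlerPencil, smul_sub, smul_smul, smul_smul, hX, mul_one]
  exact h

end ProperRationalFunctions

/-! ### The Fiedler pencil of a system matrix -/

section FiedlerMatrices

variable {m n r k : ℕ} (A : Fin (m + 1) → Matrix (Fin n) (Fin n) ℂ) (S : Realization (Fin n) r)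

/-- The coefficients `A_1, …, A_m` as a sequence, `tailCoeff A j = A_{j+1}` for `j < m`; beyond that
the index wraps around. -/
def tailCoeff (j : ℕ) : Matrix (Fin n) (Fin n) ℂ := A (Fin.ofNat (m + 1) (j + 1))

theorem fiedlerP_eq_fiedlerFactor (i : Fin m) :
    fiedlerP A i = fiedlerFactor m (A 0) (tailCoeff A) i := by
  obtain ⟨i | i, hi⟩ := i
  · rfl
  · have hcoeff : tailCoeff A i = A ⟨i + 1, by lia⟩ :=
      congrArg A (Fin.ext (Nat.mod_eq_of_lt (by lia)))
    simp [fiedlerP, fiedlerFactor, elemPos_succ_eq_elemSucc, hcoeff]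

theorem prod_fiedlerP (σ : Equiv.Perm (Fin m)) :
    (List.ofFn fun i ↦ fiedlerP A (σ i)).prod =
      fiedlerProd m (A 0) (tailCoeff A) (tuple σ) := by
  simp only [fiedlerP_eq_fiedlerFactor, fiedlerProd, tuple, List.map_ofFn, Function.comp_def]

theorem pencilP_eq_fiedlerPencil (σ : Equiv.Perm (Fin m)) :
    pencilP A σ = fiedlerPencil m X 1 (const (A (Fin.last m))) (const (A 0))
      (fun j ↦ const (tailCoeff A j)) (tuple σ) := by
  have hlead : const (leadBlock m (A (Fin.last m))) = leadBlock m (const (A (Fin.last m))) :=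
    leadBlock_map Polynomial.C m _
  have hprod : const (fiedlerProd m (A 0) (tailCoeff A) (tuple σ)) =
      fiedlerProd m (const (A 0)) (fun j ↦ const (tailCoeff A j)) (tuple σ) :=
    fiedlerProd_map _ _ Polynomial.C _
  rw [pencilP, fiedlerPNeg, elemNegTop_eq_leadBlock, prod_fiedlerP, hlead, hprod, fiedlerPencil,
    one_smul]

theorem matPoly_eq_homPoly (A : Fin (k + 1 + 1) → Matrix (Fin n) (Fin n) ℂ) :
    matPoly A = homPoly k X 1 (const (A (Fin.last (k + 1)))) (const (A 0))
      fun j ↦ const (tailCoeff A j) := by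
  have htail (j : Fin k) : A j.succ.castSucc = tailCoeff A j :=
    congrArg A (Fin.ext (Nat.mod_eq_of_lt (by simp)).symm)
  rw [matPoly, Fin.sum_univ_castSucc, Fin.sum_univ_succ, homPoly, Finset.sum_range]
  simp only [htail]
  simp [add_comm, add_left_comm]

/-- The Fiedler matrices of the system matrix, indexed like `fiedlerFactor`. -/
def systemFactor : ℕ → Matrix ((Fin m × Fin n) ⊕ Fin r) ((Fin m × Fin n) ⊕ Fin r) ℂ
  | 0 => Matrix.fromBlocks (fiedlerFactor m (A 0) (tailCoeff A) 0) (-blockCol m 0 S.C)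
      (-blockRow m 0 S.B) (-S.A)
  | i + 1 => Matrix.fromBlocks (fiedlerFactor m (A 0) (tailCoeff A) (i + 1)) 0 0 1

theorem fiedlerS_eq_systemFactor (i : Fin m) : fiedlerS A S i = systemFactor A S i := by
  rw [fiedlerS, fiedlerP_eq_fiedlerFactor]
  obtain ⟨i | i, hi⟩ := i <;> rfl

theorem prod_systemFactor_of_notMem {l : List ℕ} (hl : 0 ∉ l) :
    (l.map (systemFactor A S)).prod =
      Matrix.fromBlocks (fiedlerProd m (A 0) (tailCoeff A) l) 0 0 1 := by
  induction l with
  | nil => simp [fiedlerProd]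
  | cons i l ih =>
    obtain _ | i := i
    · simp at hl
    · rw [List.map_cons, List.prod_cons, ih (List.not_mem_of_not_mem_cons hl), systemFactor,
        Matrix.fromBlocks_multiply, fiedlerProd_cons]
      simp

theorem prod_systemFactor {l₁ l₂ : List ℕ} (hl : (l₁ ++ 0 :: l₂).Perm (List.range m)) :
    ((l₁ ++ 0 :: l₂).map (systemFactor A S)).prod =
      Matrix.fromBlocks (fiedlerProd m (A 0) (tailCoeff A) (l₁ ++ 0 :: l₂))
        (-blockCol m (inversionCount l₁) S.C) (-blockRow m (inversionCount l₂.reverse) S.B)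
        (-S.A) := by
  have hnodup : (l₁ ++ 0 :: l₂).Nodup := hl.nodup_iff.2 List.nodup_range
  have hlt (i : ℕ) (hi : i ∈ l₁ ∨ i = 0 ∨ i ∈ l₂) : i < m :=
    List.mem_range.1 (hl.mem_iff.1 (by simpa using hi))
  have hcol : fiedlerProd m (A 0) (tailCoeff A) l₁ * blockCol m 0 S.C =
      blockCol m (inversionCount l₁) S.C := by
    rw [← unitCol_mul, ← Matrix.mul_assoc, fiedlerProd_mul_unitCol _ _ (by grind) (by grind),
      unitCol_mul]
  have hrow : blockRow m 0 S.B * fiedlerProd m (A 0) (tailCoeff A) l₂ =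
      blockRow m (inversionCount l₂.reverse) S.B := by
    rw [← mul_unitRow, Matrix.mul_assoc, unitRow_mul_fiedlerProd _ _ (by grind) (by grind),
      mul_unitRow]
  rw [List.map_append, List.map_cons, List.prod_append, List.prod_cons,
    prod_systemFactor_of_notMem A S (by grind), prod_systemFactor_of_notMem A S (by grind),
    systemFactor, Matrix.fromBlocks_multiply, Matrix.fromBlocks_multiply, fiedlerProd_append,
    fiedlerProd_cons]
  simp [hcol, hrow]

/-- The realization `L_σ(λ) + (e_{m-i₀} ⊗ C) (λ E - A)⁻¹ (e_{m-c₀}ᵀ ⊗ B)`. -/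
def pencilRealization (σ : Equiv.Perm (Fin m)) (c₀ i₀ : ℕ) : Realization (Fin m × Fin n) r :=
  ⟨pencilP A σ, blockCol m i₀ S.C, S.E, S.A, blockRow m c₀ S.B, S.det_E⟩

theorem pencilS_eq_systemMatrix {σ : Equiv.Perm (Fin m)} {l₁ l₂ : List ℕ}
    (hσ : tuple σ = l₁ ++ 0 :: l₂) :
    pencilS A S σ = (pencilRealization A S σ (inversionCount l₂.reverse)
      (inversionCount l₁)).systemMatrix := by
  have hprod : (List.ofFn fun i ↦ fiedlerS A S (σ i)).prod =
      ((tuple σ).map (systemFactor A S)).prod := by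
    simp only [fiedlerS_eq_systemFactor, tuple, List.map_ofFn, Function.comp_def]
  rw [pencilS, hprod, hσ, prod_systemFactor A S (hσ ▸ tuple_perm σ), ← hσ, ← prod_fiedlerP,
    fiedlerSNeg]
  ext (i | i) (j | j) <;> simp [pencilRealization, Realization.systemMatrix, pencilP, const]
  ring

theorem const_blockCol (i : ℕ) (Y : Matrix (Fin n) (Fin r) ℂ) :
    const (blockCol m i Y) = unitCol ℂ[X] n m i * const Y := by
  rw [← unitCol_mul, const_mul]
  exact congrArg (· * _) (unitCol_map n Polynomial.C i)

theorem const_blockRow (i : ℕ) (Y : Matrix (Fin r) (Fin n) ℂ) :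
    const (blockRow m i Y) = const Y * unitRow ℂ[X] n m i := by
  rw [← mul_unitRow, const_mul]
  exact congrArg (_ * ·) (unitRow_map n Polynomial.C i)

theorem exists_pencilRealization_normalization
    (A : Fin (k + 1 + 1) → Matrix (Fin n) (Fin n) ℂ) {σ : Equiv.Perm (Fin (k + 1))}
    {l₁ l₂ : List ℕ} (hσ : tuple σ = l₁ ++ 0 :: l₂) :
    ∃ U V : Matrix (Fin (k + 1) × Fin n) (Fin (k + 1) × Fin n) ℂ[X],
      IsUnit U.det ∧ IsUnit V.det ∧
      U * pencilP A σ * V = elemZero (k + 1) (matPoly A) ∧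
      U * const (blockCol (k + 1) (inversionCount l₁) S.C) = blockCol (k + 1) 0 (const S.C) ∧
      const (blockRow (k + 1) (inversionCount l₂.reverse) S.B) * V =
        blockRow (k + 1) 0 (const S.B) := by
  obtain ⟨U, V, hU, hV, hP, hC, hB⟩ := exists_fiedlerPencil_normalization
    (hσ ▸ tuple_perm σ) X (const (A (Fin.last (k + 1)))) (const (A 0))
    fun j ↦ const (tailCoeff A j)
  refine ⟨U, V, hU, hV, ?_, ?_, ?_⟩
  · rw [pencilP_eq_fiedlerPencil, hσ, hP, matPoly_eq_homPoly]
  · rw [const_blockCol, ← Matrix.mul_assoc, hC, unitCol_mul]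
  · rw [const_blockRow, Matrix.mul_assoc, hB, mul_unitRow]

end FiedlerMatrices

section Linearization

variable {m n r : ℕ} {S : Realization (Fin n) r} {T : Realization (Fin m × Fin n) r}
  {U V : Matrix (Fin m × Fin n) (Fin m × Fin n) ℂ[X]}

theorem isUnimodular_of_isUnit_det {ι : Type*} [Fintype ι] [DecidableEq ι] {U : Matrix ι ι ℂ[X]}
    (hU : IsUnit U.det) : IsUnimodular U := by
  obtain ⟨c, hc, h⟩ := Polynomial.isUnit_iff.1 hU
  exact ⟨c, hc.ne_zero, h.symm⟩

theorem systemEquivalent_systemMatrix (hE : T.E = S.E) (hA : T.A = S.A) (hU : IsUnit U.det)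
    (hV : IsUnit V.det) (hP : U * T.P * V = elemZero m S.P)
    (hC : U * const T.C = blockCol m 0 (const S.C))
    (hB : const T.B * V = blockRow m 0 (const S.B)) : SystemEquivalent S T.systemMatrix := by
  refine ⟨U, V, 1, 1, isUnimodular_of_isUnit_det hU, isUnimodular_of_isUnit_det hV, by simp,
    by simp, ?_⟩
  rw [show const (1 : Matrix (Fin r) (Fin r) ℂ) = 1 by simp [const], Realization.systemMatrix,
    Matrix.fromBlocks_multiply, Matrix.fromBlocks_multiply]
  simp [diagOne, Realization.systemMatrix, hE, hA, hP, hC, hB]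

theorem Realization.IsMinimal.of_equivalent (hS : S.IsMinimal) (hm : 0 < m) (hE : T.E = S.E)
    (hA : T.A = S.A) (hP : U * T.P * V = elemZero m S.P)
    (hC : U * const T.C = blockCol m 0 (const S.C))
    (hB : const T.B * V = blockRow m 0 (const S.B)) : T.IsMinimal := by
  set p := unitRow ℂ[X] n m 0
  set q := unitCol ℂ[X] n m 0
  have hpq : p * q = 1 := unitRow_mul_unitCol_self ℂ[X] n hm
  have hP' : p * U * T.P * (V * q) = S.P :=
    calc p * U * T.P * (V * q) = p * (U * T.P * V) * q := by simp only [Matrix.mul_assoc]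
      _ = S.P := by
        rw [hP, elemZero_eq_extendByOne, row_mul_extendByOne hpq, Matrix.mul_assoc, hpq,
          Matrix.mul_one]
  have hC' : p * U * const T.C = const S.C := by
    rw [Matrix.mul_assoc, hC, ← unitCol_mul, ← Matrix.mul_assoc, hpq, Matrix.one_mul]
  have hB' : const T.B * (V * q) = const S.B := by
    rw [← Matrix.mul_assoc, hB, ← mul_unitRow, Matrix.mul_assoc, hpq, Matrix.mul_one]
  refine hS.of_transfer_eq_mul (p * U) (V * q) ?_
  simp only [Realization.transfer, ← hP', ← hC', ← hB', ← hE, ← hA, toRat_mul, Matrix.mul_add,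
    Matrix.add_mul, Matrix.mul_assoc]

/-- The strictly proper part `C (λ E - A)⁻¹ B` of a realization. -/
def Realization.strictlyProperPart {ι : Type*} (S : Realization ι r) : Matrix ι ι (RatFunc ℂ) :=
  toRat (const S.C) * (toRat ((X : ℂ[X]) • const S.E - const S.A))⁻¹ * toRat (const S.B)

theorem Realization.exists_strictlyProperPart_eq_map {ι : Type*} (S : Realization ι r) :
    ∃ H : Matrix ι ι properRing, S.strictlyProperPart = H.map properRing.subtype := by
  obtain ⟨N, hN⟩ := exists_toRat_pencil_inv_eq_map (A := S.A) S.det_E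
  refine ⟨S.C.map properConst * N * S.B.map properConst, ?_⟩
  rw [strictlyProperPart, hN, Matrix.map_mul, Matrix.map_mul, toRat_const, toRat_const]

variable {k : ℕ} (A : Fin (k + 1 + 1) → Matrix (Fin n) (Fin n) ℂ)

theorem transfer_eq_homPoly (hP : S.P = matPoly A) :
    S.transfer = homPoly k RatFunc.X 1 (toRat (const (A (Fin.last (k + 1)))))
      (toRat (const (A 0)) + S.strictlyProperPart) fun j ↦ toRat (const (tailCoeff A j)) := by
  have hmap : toRat S.P = homPoly k RatFunc.X 1 (toRat (const (A (Fin.last (k + 1)))))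
      (toRat (const (A 0))) fun j ↦ toRat (const (tailCoeff A j)) := by
    rw [hP, matPoly_eq_homPoly, toRat, homPoly_map, RatFunc.algebraMap_X, map_one]
    rfl
  rw [homPoly_add_constCoeff, one_pow, one_smul, ← hmap]
  rfl

variable (S) in
theorem pencilRealization_transfer_eq_fiedlerPencil {σ : Equiv.Perm (Fin (k + 1))}
    {l₁ l₂ : List ℕ} (hσ : tuple σ = l₁ ++ 0 :: l₂) :
    (pencilRealization A S σ (inversionCount l₂.reverse) (inversionCount l₁)).transfer =
      fiedlerPencil (k + 1) RatFunc.X 1 (toRat (const (A (Fin.last (k + 1)))))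
        (toRat (const (A 0)) + S.strictlyProperPart) (fun j ↦ toRat (const (tailCoeff A j)))
        (tuple σ) := by
  have hmap : toRat (pencilP A σ) =
      fiedlerPencil (k + 1) RatFunc.X 1 (toRat (const (A (Fin.last (k + 1)))))
        (toRat (const (A 0))) (fun j ↦ toRat (const (tailCoeff A j))) (tuple σ) := by
    rw [pencilP_eq_fiedlerPencil, toRat, fiedlerPencil_map, RatFunc.algebraMap_X, map_one]
    rfl
  have hcol (i : ℕ) : toRat (unitCol ℂ[X] n (k + 1) i) = unitCol (RatFunc ℂ) n (k + 1) i :=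
    unitCol_map n _ i
  have hrow (i : ℕ) : toRat (unitRow ℂ[X] n (k + 1) i) = unitRow (RatFunc ℂ) n (k + 1) i :=
    unitRow_map n _ i
  rw [hσ, fiedlerPencil_add_constCoeff _ _ _ _ _ _ (hσ ▸ tuple_perm σ), ← hσ, ← hmap, one_smul]
  simp only [Realization.transfer, Realization.strictlyProperPart, pencilRealization,
    const_blockCol, const_blockRow, toRat_mul, hcol, hrow, Matrix.mul_assoc]

theorem biproperEquivalent_pencilRealization (hP : S.P = matPoly A)
    {σ : Equiv.Perm (Fin (k + 1))} {l₁ l₂ : List ℕ} (hσ : tuple σ = l₁ ++ 0 :: l₂) :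
    BiproperEquivalent S.transfer
      (pencilRealization A S σ (inversionCount l₂.reverse) (inversionCount l₁)).transfer := by
  obtain ⟨H, hH⟩ := S.exists_strictlyProperPart_eq_map
  have hconst : toRat (const (A 0)) + S.strictlyProperPart =
      ((A 0).map properConst + H).map properRing.subtype := by
    rw [hH, toRat_const, Matrix.map_add _ (map_add _)]
  rw [transfer_eq_homPoly A hP, pencilRealization_transfer_eq_fiedlerPencil S A hσ, hconst]
  simp only [toRat_const]
  exact biproperEquivalent_fiedlerPencil (tuple_perm σ) _ _ _

theorem exists_pencilP_eq_const_sub_X_smul_const (A : Fin (m + 1) → Matrix (Fin n) (Fin n) ℂ)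
    (σ : Equiv.Perm (Fin m)) :
    ∃ Xc Yc, pencilP A σ = const Xc - (X : ℂ[X]) • const Yc := by
  refine ⟨-(List.ofFn fun i ↦ fiedlerP A (σ i)).prod, -fiedlerPNeg A, ?_⟩
  ext
  simp [pencilP, const]
  ring

end Linearization

end

end Fiedler

theorem theorem3p9 (m n r : ℕ) (hm : 1 ≤ m)
    (A : Fin (m + 1) → Matrix (Fin n) (Fin n) ℂ) (hlead : A (Fin.last m) ≠ 0)
    (S : Fiedler.Realization (Fin n) r) (hP : S.P = Fiedler.matPoly A) (hmin : S.IsMinimal)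
    (σ : Equiv.Perm (Fin m)) :
    Fiedler.IsRosenbrockStrongLinearization S (Fiedler.pencilS A S σ) ∧
    Fiedler.SystemEquivalent S (Fiedler.pencilS A S σ) ∧
    ∃ c₀ i₀ : ℕ, Fiedler.HasConsecutions (Fiedler.tuple σ) 0 c₀ ∧
      Fiedler.HasInversions (Fiedler.tuple σ) 0 i₀ ∧
      ∃ T : Fiedler.Realization (Fin m × Fin n) r,
        T.P = Fiedler.pencilP A σ ∧ T.C = Fiedler.blockCol m i₀ S.C ∧ T.E = S.E ∧ T.A = S.A ∧
        T.B = Fiedler.blockRow m c₀ S.B ∧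
        Fiedler.pencilS A S σ = T.systemMatrix ∧
        Fiedler.BiproperEquivalent S.transfer T.transfer := by
  obtain ⟨k, rfl⟩ : ∃ k, m = k + 1 := ⟨m - 1, by lia⟩
  obtain ⟨l₁, l₂, hσ⟩ := List.append_of_mem
    ((Fiedler.tuple_perm σ).mem_iff.2 (List.mem_range.2 k.succ_pos))
  have hnodup : (l₁ ++ 0 :: l₂).Nodup :=
    hσ ▸ (Fiedler.tuple_perm σ).nodup_iff.2 List.nodup_range
  set T := Fiedler.pencilRealization A S σ (Fiedler.inversionCount l₂.reverse)
    (Fiedler.inversionCount l₁)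
  obtain ⟨U, V, hU, hV, hPencil, hC, hB⟩ :=
    Fiedler.exists_pencilRealization_normalization S A hσ
  rw [← hP] at hPencil
  have hsystem : Fiedler.pencilS A S σ = T.systemMatrix := Fiedler.pencilS_eq_systemMatrix A S hσ
  have hunimodular : Fiedler.SystemEquivalent S (Fiedler.pencilS A S σ) :=
    hsystem ▸ Fiedler.systemEquivalent_systemMatrix (T := T) rfl rfl hU hV hPencil hC hB
  have hminT : T.IsMinimal := hmin.of_equivalent k.succ_pos rfl rfl hPencil hC hB
  have hbiproper : Fiedler.BiproperEquivalent S.transfer T.transfer :=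
    Fiedler.biproperEquivalent_pencilRealization A hP hσ
  refine ⟨⟨T, Fiedler.exists_pencilP_eq_const_sub_X_smul_const A σ, hsystem, hminT, hunimodular,
    hbiproper⟩, hunimodular, _, _, hσ ▸ Fiedler.hasConsecutions_inversionCount (by grind),
    hσ ▸ Fiedler.hasInversions_inversionCount (by grind), T, rfl, rfl, rfl, rfl, rfl, hsystem,
    hbiproper⟩
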